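/- Let $\mathcal K$ be a tt-category, i.e. an essentially small, idempotent complete triangulated category with a symmetric monoidal structure $(\otimes,\mathbb 1)$ whose tensor product is exact in each variable. Assume that $\mathcal K$ is local: whenever $x\otimes y=0$, one of $x$, $y$ is $\otimes$-nilpotent (some tensor power of it is zero). A tt-ring in $\mathcal K$ is a commutative ring object $(A,\mu,\eta)$ (associative and unital) which is separable, i.e. $\mu:A\otimes A\to A$ has a section which is a morphism of $A,A$-bimodules. For tt-rings $A$, $B$, the tt-ring $A\times B$ is $A\oplus B$ with component-wise structure, and $A\otimes B$ has the usual tensor product ring structure. The splitting tower $A^{[0]}\to A^{[1]}\to A^{[2]}\to\cdots$ of a tt-ring $A$ is the sequence of homomorphisms of tt-rings which starts with $\eta:A^{[0]}=\mathbb 1\to A^{[1]}=A$ and in which, for $n\ge 1$, the $A^{[n]}$-algebra $A^{[n+1]}$ is characterized (up to isomorphism) by the existence of an isomorphism of $A^{[n]}$-algebras $$h:A^{[n]}\otimes_{A^{[n-1]}}A^{[n]}\;\xrightarrow{\ \sim\ }\;A^{[n]}\times A^{[n+1]}$$ whose first component $\mathrm{pr}_1 h$ is the multiplication; here the left-hand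 side is an $A^{[n]}$-algebra through its left factor. One says that $A$ has finite degree $d\in\mathbb N$, and writes $\deg(A)=d$, if $A^{[d]}\ne 0$ and $A^{[d+1]}=0$. If $A$ and $B$ are tt-rings of finite degree in the local tt-category $\mathcal K$, then $A\times B$ and $A\otimes B$ have finite degree, and $$\deg(A\times B)=\deg(A)+\deg(B),\qquad \deg(A\otimes B)=\deg(A)\cdot\deg(B).$$ -/

import Mathlib

open CategoryTheory MonoidalCategory Limits
open scoped MonObj
universe w v u
namespace TT
variable {C : Type u} [Category.{v} C] [MonoidalCategory C]

/-- A ring object `A` is separable if its multiplication `A ⊗ A ⟶ A` has a section `s` which is a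
morphism of `A,A`-bimodules. The last two equations say `a • s b = s (a * b)` and
`s a • b = s (a * b)`. -/
class IsSeparableRing (A : C) [MonObj A] : Prop where
  exists_section : ∃ s : A ⟶ A ⊗ A, s ≫ μ = 𝟙 A ∧
    A ◁ s ≫ (α_ A A A).inv ≫ μ ▷ A = μ ≫ s ∧
    s ▷ A ≫ (α_ A A A).hom ≫ A ◁ μ = μ ≫ s

instance : IsSeparableRing (𝟙_ C) where
  exists_section := ⟨(λ_ (𝟙_ C)).inv, by simp, by dsimp; monoidal, by dsimp; monoidal⟩

theorem isMonHom_one {A : C} [MonObj A] : IsMonHom η[A] :=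
  ⟨Category.id_comp _, by simp [MonoidalCategory.tensorHom_def, unitors_equal]⟩

/-- Multiplication by an element `e` of a ring object. -/
def mulBy {R : C} [MonObj R] (e : 𝟙_ C ⟶ R) : R ⟶ R := (λ_ R).inv ≫ e ▷ R ≫ μ

theorem mul_mulBy {R : C} [MonObj R] (e : 𝟙_ C ⟶ R) : mulBy e ▷ R ≫ μ = μ ≫ mulBy e := by
  have h : (μ : R ⊗ R ⟶ R) ≫ (λ_ R).inv ≫ e ▷ R =
      (λ_ (R ⊗ R)).inv ≫ e ▷ (R ⊗ R) ≫ R ◁ μ := by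
    rw [← whisker_exchange, leftUnitor_inv_naturality_assoc]
  simp only [mulBy, comp_whiskerRight, Category.assoc, MonObj.mul_assoc]
  rw [reassoc_of% h]
  simp

theorem mulBy_comp_mulBy {R : C} [MonObj R] (e : 𝟙_ C ⟶ R) (he : e ≫ mulBy e = e) :
    mulBy e ≫ mulBy e = mulBy e := by
  nth_rw 1 [mulBy]
  rw [Category.assoc, Category.assoc, ← mul_mulBy, ← comp_whiskerRight_assoc, he]
  rfl

theorem mulBy_map {R S : C} [MonObj R] [MonObj S] (e : 𝟙_ C ⟶ R) (φ : R ⟶ S) [IsMonHom φ] :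
    mulBy e ≫ φ = φ ≫ mulBy (e ≫ φ) := by
  simp only [mulBy, Category.assoc, IsMonHom.mul_hom]
  rw [MonoidalCategory.tensorHom_def', leftUnitor_inv_naturality_assoc, comp_whiskerRight_assoc,
    Category.assoc, whisker_exchange_assoc, whisker_exchange_assoc, whisker_exchange_assoc]

section
variable [SymmetricCategory C]

theorem tensorμ_self_inv (X Y Z W : C) : tensorμ X Y Z W ≫ tensorμ X Z Y W = 𝟙 _ := by
  rw [← tensorμ_tensorδ X Y Z W]
  congr 1
  simp only [tensorμ, tensorδ, SymmetricCategory.braiding_swap_eq_inv_braiding Y Z]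

instance (A B : C) [MonObj A] [MonObj B] [IsSeparableRing A] [IsSeparableRing B] :
    IsSeparableRing (A ⊗ B) where
  exists_section := by
    obtain ⟨s, s1, s2, s3⟩ := IsSeparableRing.exists_section (A := A)
    obtain ⟨t, t1, t2, t3⟩ := IsSeparableRing.exists_section (A := B)
    have hinv := @tensorμ_self_inv C _ _ _
    refine ⟨(s ⊗ₘ t) ≫ tensorμ A A B B, ?_, ?_, ?_⟩
    · rw [MonObj.tensorObj.mul_def, Category.assoc, reassoc_of% (hinv A A B B),
        tensorHom_comp_tensorHom, s1, t1, id_tensorHom_id]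
    · have key : (A ⊗ B) ◁ tensorμ A A B B ≫ (α_ _ _ _).inv ≫ tensorμ A B A B ▷ (A ⊗ B) =
          tensorμ A B (A ⊗ A) (B ⊗ B) ≫ ((α_ A A A).inv ⊗ₘ (α_ B B B).inv) ≫
            tensorμ (A ⊗ A) A (B ⊗ B) B := by
        have h := tensor_associativity A B A B A B
        have h2 : tensorμ (A ⊗ A) (B ⊗ B) A B ≫ ((α_ A A A).hom ⊗ₘ (α_ B B B).hom) ≫
            ((α_ A A A).inv ⊗ₘ (α_ B B B).inv) ≫ tensorμ (A ⊗ A) A (B ⊗ B) B = 𝟙 _ := by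
          rw [tensorHom_comp_tensorHom_assoc]
          simp [hinv]
        have h' := congr((A ⊗ B) ◁ tensorμ A A B B ≫ (α_ _ _ _).inv ≫ $h ≫
            ((α_ A A A).inv ⊗ₘ (α_ B B B).inv) ≫ tensorμ (A ⊗ A) A (B ⊗ B) B)
        simp only [Category.assoc] at h'
        rw [h2, Category.comp_id, Iso.inv_hom_id_assoc, ← whiskerLeft_comp_assoc, hinv,
          whiskerLeft_id, Category.id_comp] at h'
        exact h'
      simp only [MonObj.tensorObj.mul_def, comp_whiskerRight, whiskerLeft_comp, Category.assoc]
      rw [reassoc_of% key, tensorμ_natural_right_assoc, tensorHom_comp_tensorHom_assoc,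
        tensorHom_comp_tensorHom_assoc, ← s2, ← t2]
      have hn := tensorμ_natural μ[A] (𝟙 A) μ[B] (𝟙 B)
      simp only [tensorHom_id, id_whiskerRight] at hn
      simp only [Category.assoc, ← tensorHom_comp_tensorHom, hn]
    · have key : tensorμ A A B B ▷ (A ⊗ B) ≫ (α_ _ _ _).hom ≫ (A ⊗ B) ◁ tensorμ A B A B =
          tensorμ (A ⊗ A) (B ⊗ B) A B ≫ ((α_ A A A).hom ⊗ₘ (α_ B B B).hom) ≫
            tensorμ A (A ⊗ A) B (B ⊗ B) := by
        have h := tensor_associativity A B A B A B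
        have h' := congr(tensorμ A A B B ▷ (A ⊗ B) ≫ $h ≫ tensorμ A (A ⊗ A) B (B ⊗ B))
        simp only [Category.assoc] at h'
        rw [hinv, Category.comp_id, ← comp_whiskerRight_assoc, hinv,
          id_whiskerRight, Category.id_comp] at h'
        exact h'.symm
      simp only [MonObj.tensorObj.mul_def, comp_whiskerRight, whiskerLeft_comp, Category.assoc]
      rw [reassoc_of% key, tensorμ_natural_left_assoc, tensorHom_comp_tensorHom_assoc,
        tensorHom_comp_tensorHom_assoc, ← s3, ← t3]
      have hn := tensorμ_natural (𝟙 A) μ[A] (𝟙 B) μ[B]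
      simp only [id_tensorHom, whiskerLeft_id] at hn
      simp only [Category.assoc, ← tensorHom_comp_tensorHom, hn]
end

theorem mon_one_mul_aux {X A : C} [MonObj A] (f : X ⟶ A) (e : 𝟙_ C ⟶ X) (h : e ≫ f = η) :
    e ▷ X ≫ (f ⊗ₘ f) ≫ μ = (λ_ X).hom ≫ f := by
  rw [MonoidalCategory.tensorHom_def, Category.assoc, ← comp_whiskerRight_assoc, h, ← whisker_exchange_assoc, MonObj.one_mul, leftUnitor_naturality]

theorem mon_mul_one_aux {X A : C} [MonObj A] (f : X ⟶ A) (e : 𝟙_ C ⟶ X) (h : e ≫ f = η) :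
    X ◁ e ≫ (f ⊗ₘ f) ≫ μ = (ρ_ X).hom ≫ f := by
  rw [MonoidalCategory.tensorHom_def', Category.assoc, ← whiskerLeft_comp_assoc, h, whisker_exchange_assoc, MonObj.mul_one, rightUnitor_naturality]

theorem mon_mul_assoc_aux {X A : C} [MonObj A] (f : X ⟶ A) (m : X ⊗ X ⟶ X)
    (h : m ≫ f = (f ⊗ₘ f) ≫ μ) :
    (m ▷ X ≫ m) ≫ f = ((α_ X X X).hom ≫ X ◁ m ≫ m) ≫ f := by
  have h1 : m ▷ X ≫ (f ⊗ₘ f) = ((f ⊗ₘ f) ⊗ₘ f) ≫ μ ▷ A := by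
    rw [← tensorHom_id, ← tensorHom_id, tensorHom_comp_tensorHom, tensorHom_comp_tensorHom, h]; simp
  have h2 : X ◁ m ≫ (f ⊗ₘ f) = (f ⊗ₘ (f ⊗ₘ f)) ≫ A ◁ μ := by
    rw [← id_tensorHom, ← id_tensorHom, tensorHom_comp_tensorHom, tensorHom_comp_tensorHom, h]; simp
  simp only [Category.assoc, h]
  rw [reassoc_of% h1, reassoc_of% h2, MonObj.mul_assoc, associator_naturality_assoc]

theorem sep_left_aux {X A : C} [MonObj A] (m : X ⊗ X ⟶ X) (p : X ⟶ A) (i : A ⟶ X)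
    (s : A ⟶ A ⊗ A) (h : X ◁ i ≫ m = p ▷ A ≫ μ ≫ i) :
    X ◁ (s ≫ (i ⊗ₘ i)) ≫ (α_ X X X).inv ≫ m ▷ X =
      p ▷ A ≫ A ◁ s ≫ (α_ A A A).inv ≫ μ ▷ A ≫ (i ⊗ₘ i) := by
  have h1 : (μ ▷ A ≫ (i ⊗ₘ i) : (A ⊗ A) ⊗ A ⟶ _) = ((μ ≫ i) ⊗ₘ i) := by
    rw [← tensorHom_id, tensorHom_comp_tensorHom, Category.id_comp]
  have h2 : (p ▷ A) ▷ A ≫ ((μ ≫ i) ⊗ₘ i) = (((X ◁ i) ≫ m) ⊗ₘ i) := by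
    rw [h, ← tensorHom_id, tensorHom_comp_tensorHom, Category.id_comp]
  rw [h1, ← whisker_exchange_assoc, associator_inv_naturality_left_assoc, h2, whiskerLeft_comp,
    Category.assoc, ← id_tensorHom X (i ⊗ₘ i), associator_inv_naturality_assoc, ← tensorHom_id m,
    tensorHom_comp_tensorHom, id_tensorHom, Category.comp_id]

theorem sep_right_aux {X A : C} [MonObj A] (m : X ⊗ X ⟶ X) (p : X ⟶ A) (i : A ⟶ X)
    (s : A ⟶ A ⊗ A) (h : i ▷ X ≫ m = A ◁ p ≫ μ ≫ i) :
    (s ≫ (i ⊗ₘ i)) ▷ X ≫ (α_ X X X).hom ≫ X ◁ m =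
      A ◁ p ≫ s ▷ A ≫ (α_ A A A).hom ≫ A ◁ μ ≫ (i ⊗ₘ i) := by
  have h1 : (A ◁ μ ≫ (i ⊗ₘ i) : A ⊗ (A ⊗ A) ⟶ _) = (i ⊗ₘ (μ ≫ i)) := by
    rw [← id_tensorHom, tensorHom_comp_tensorHom, Category.id_comp]
  have h2 : A ◁ (A ◁ p) ≫ (i ⊗ₘ (μ ≫ i)) = (i ⊗ₘ (i ▷ X ≫ m)) := by
    rw [h, ← id_tensorHom, tensorHom_comp_tensorHom, Category.id_comp]
  rw [h1, whisker_exchange_assoc, associator_naturality_right_assoc, h2, comp_whiskerRight,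
    Category.assoc, ← tensorHom_id (i ⊗ₘ i) X, associator_naturality_assoc, ← id_tensorHom _ m,
    tensorHom_comp_tensorHom, tensorHom_id, Category.comp_id]

section
variable [Preadditive C] [HasBinaryBiproducts C]

/-- The product of two ring objects: the direct sum with the component-wise structure. -/
noncomputable instance prodMonObj (A B : C) [MonObj A] [MonObj B] : MonObj (A ⊞ B) where
  one := biprod.lift η η
  mul := biprod.lift ((biprod.fst ⊗ₘ biprod.fst) ≫ μ) ((biprod.snd ⊗ₘ biprod.snd) ≫ μ)
  one_mul := by
    ext
    · simpa using mon_one_mul_aux (A := A) biprod.fst (biprod.lift η η) (by simp)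
    · simpa using mon_one_mul_aux (A := B) biprod.snd (biprod.lift η η) (by simp)
  mul_one := by
    ext
    · simpa using mon_mul_one_aux (A := A) biprod.fst (biprod.lift η η) (by simp)
    · simpa using mon_mul_one_aux (A := B) biprod.snd (biprod.lift η η) (by simp)
  mul_assoc := by
    ext
    · exact mon_mul_assoc_aux (A := A) biprod.fst _ (by simp)
    · exact mon_mul_assoc_aux (A := B) biprod.snd _ (by simp)

theorem prod_one_def (A B : C) [MonObj A] [MonObj B] : η[A ⊞ B] =
    biprod.lift η η := rfl

theorem prod_mul_def (A B : C) [MonObj A] [MonObj B] : μ[A ⊞ B] =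
    biprod.lift ((biprod.fst ⊗ₘ biprod.fst) ≫ μ) ((biprod.snd ⊗ₘ biprod.snd) ≫ μ) := rfl

instance [BraidedCategory C] (A B : C) [MonObj A] [MonObj B] [IsCommMonObj A] [IsCommMonObj B] :
    IsCommMonObj (A ⊞ B) where
  mul_comm := by
    ext
    · simp [prod_mul_def, ← BraidedCategory.braiding_naturality_assoc]
    · simp [prod_mul_def, ← BraidedCategory.braiding_naturality_assoc]

instance [MonoidalPreadditive C] (A B : C) [MonObj A] [MonObj B] [IsSeparableRing A] [IsSeparableRing B] :
    IsSeparableRing (A ⊞ B) where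
  exists_section := by
    obtain ⟨s, s1, s2, s3⟩ := IsSeparableRing.exists_section (A := A)
    obtain ⟨t, t1, t2, t3⟩ := IsSeparableRing.exists_section (A := B)
    refine ⟨biprod.fst ≫ s ≫ (biprod.inl ⊗ₘ biprod.inl) + biprod.snd ≫ t ≫ (biprod.inr ⊗ₘ biprod.inr), ?_, ?_, ?_⟩
    · ext <;> simp [prod_mul_def, s1, t1]
    · have hA : μ[A ⊞ B] ≫ biprod.fst = _ ≫ μ := biprod.lift_fst _ _
      have hB : μ[A ⊞ B] ≫ biprod.snd = _ ≫ μ := biprod.lift_snd _ _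
      have h1 : (A ⊞ B) ◁ biprod.inl ≫ μ[A ⊞ B] = biprod.fst ▷ A ≫ μ ≫ biprod.inl := by
        ext <;> simp [prod_mul_def, ← id_tensorHom, ← tensorHom_id]
      have h2 : (A ⊞ B) ◁ biprod.inr ≫ μ[A ⊞ B] = biprod.snd ▷ B ≫ μ ≫ biprod.inr := by
        ext <;> simp [prod_mul_def, ← id_tensorHom, ← tensorHom_id]
      rw [Preadditive.comp_add, reassoc_of% hA, reassoc_of% hB, ← reassoc_of% s2, ← reassoc_of% t2]
      simp only [MonoidalPreadditive.whiskerLeft_add, Preadditive.add_comp]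
      rw [whiskerLeft_comp _ biprod.fst, whiskerLeft_comp _ biprod.snd, Category.assoc, Category.assoc,
        sep_left_aux _ _ _ _ h1, sep_left_aux _ _ _ _ h2, ← tensorHom_def'_assoc, ← tensorHom_def'_assoc]
    · have hA : μ[A ⊞ B] ≫ biprod.fst = _ ≫ μ := biprod.lift_fst _ _
      have hB : μ[A ⊞ B] ≫ biprod.snd = _ ≫ μ := biprod.lift_snd _ _
      have h1 : biprod.inl ▷ (A ⊞ B) ≫ μ[A ⊞ B] = A ◁ biprod.fst ≫ μ ≫ biprod.inl := by
        ext <;> simp [prod_mul_def, ← id_tensorHom, ← tensorHom_id]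
      have h2 : biprod.inr ▷ (A ⊞ B) ≫ μ[A ⊞ B] = B ◁ biprod.snd ≫ μ ≫ biprod.inr := by
        ext <;> simp [prod_mul_def, ← id_tensorHom, ← tensorHom_id]
      rw [Preadditive.comp_add, reassoc_of% hA, reassoc_of% hB, ← reassoc_of% s3, ← reassoc_of% t3]
      simp only [MonoidalPreadditive.add_whiskerRight, Preadditive.add_comp]
      rw [comp_whiskerRight biprod.fst, comp_whiskerRight biprod.snd, Category.assoc, Category.assoc,
        sep_right_aux _ _ _ _ h1, sep_right_aux _ _ _ _ h2, ← MonoidalCategory.tensorHom_def_assoc,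
        ← MonoidalCategory.tensorHom_def_assoc]

end

section
variable [SymmetricCategory C]

variable (C) in
/-- A tt-ring: a commutative separable ring object. -/
structure TTRing where
  X : C
  [mon : MonObj X]
  [comm : IsCommMonObj X]
  [sep : IsSeparableRing X]

attribute [instance] TTRing.mon TTRing.comm TTRing.sep

theorem exists_factor_of_idempotent [IsIdempotentComplete C] (R : C) [MonObj R]
    [IsCommMonObj R] [IsSeparableRing R] (p : R ⟶ R)
    (hp : p ≫ p = p) (hl : p ▷ R ≫ μ = μ ≫ p) :
    ∃ (S : TTRing C) (r : R ⟶ S.X) (i : S.X ⟶ R),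
      IsMonHom r ∧ i ≫ r = 𝟙 _ ∧ r ≫ i = p := by
  obtain ⟨Y, i, r, hir, hri⟩ := IsIdempotentComplete.idempotents_split R p hp
  have hr : R ◁ p ≫ μ = μ ≫ p := by
    rw [← IsCommMonObj.mul_comm R, ← Category.assoc, BraidedCategory.braiding_naturality_right,
      Category.assoc, hl, Category.assoc]
  have hpr : p ≫ r = r := by rw [← hri, Category.assoc, hir, Category.comp_id]
  have hip : i ≫ p = i := by rw [← hri, reassoc_of% hir]
  have hmul : (r ⊗ₘ r) ≫ (i ⊗ₘ i) ≫ μ ≫ r = μ ≫ r := by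
    rw [tensorHom_comp_tensorHom_assoc, hri, MonoidalCategory.tensorHom_def, Category.assoc,
      reassoc_of% hr, hpr, reassoc_of% hl, hpr]
  have hl' : i ▷ R ≫ μ ≫ r = Y ◁ r ≫ (i ⊗ₘ i) ≫ μ ≫ r := by
    rw [← id_tensorHom, tensorHom_comp_tensorHom_assoc, Category.id_comp, hri,
      MonoidalCategory.tensorHom_def, Category.assoc, reassoc_of% hr, hpr]
  have hr' : R ◁ i ≫ μ ≫ r = r ▷ Y ≫ (i ⊗ₘ i) ≫ μ ≫ r := by
    rw [← tensorHom_id, tensorHom_comp_tensorHom_assoc, Category.id_comp, hri,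
      MonoidalCategory.tensorHom_def', Category.assoc, reassoc_of% hl, hpr]
  let : MonObj Y :=
    { one := η ≫ r
      mul := (i ⊗ₘ i) ≫ μ ≫ r
      one_mul := by
        rw [comp_whiskerRight, Category.assoc, ← hr', ← whisker_exchange_assoc, MonObj.one_mul_assoc,
          leftUnitor_naturality_assoc, hir, Category.comp_id]
      mul_one := by
        rw [whiskerLeft_comp, Category.assoc, ← hl', whisker_exchange_assoc, MonObj.mul_one_assoc,
          rightUnitor_naturality_assoc, hir, Category.comp_id]
      mul_assoc := by
        have h1 : ((i ⊗ₘ i) ≫ μ ≫ r) ▷ Y ≫ (i ⊗ₘ i) = ((i ⊗ₘ i) ⊗ₘ i) ≫ μ ▷ R ≫ p ▷ R := by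
          rw [← tensorHom_id, ← tensorHom_id, ← tensorHom_id, tensorHom_comp_tensorHom,
            tensorHom_comp_tensorHom, tensorHom_comp_tensorHom]
          simp [hri]
        have h2 : Y ◁ ((i ⊗ₘ i) ≫ μ ≫ r) ≫ (i ⊗ₘ i) = (i ⊗ₘ (i ⊗ₘ i)) ≫ R ◁ μ ≫ R ◁ p := by
          rw [← id_tensorHom, ← id_tensorHom, ← id_tensorHom, tensorHom_comp_tensorHom,
            tensorHom_comp_tensorHom, tensorHom_comp_tensorHom]
          simp [hri]
        rw [reassoc_of% h1, reassoc_of% h2, reassoc_of% hl, reassoc_of% hr, hpr,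
          MonObj.mul_assoc_assoc, associator_naturality_assoc] }
  have hμ : μ[Y] = (i ⊗ₘ i) ≫ μ ≫ r := rfl
  have hrm : IsMonHom r := ⟨rfl, hmul.symm⟩
  have : IsCommMonObj Y := ⟨by
    rw [hμ, ← BraidedCategory.braiding_naturality_assoc, IsCommMonObj.mul_comm_assoc]⟩
  have : IsSeparableRing Y := ⟨by
    obtain ⟨s, s1, s2, s3⟩ := IsSeparableRing.exists_section (A := R)
    have hps : p ≫ s = s ≫ p ▷ R := by
      have h : μ ≫ p ≫ s = μ ≫ s ≫ p ▷ R := by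
        rw [← reassoc_of% hl, ← s2, ← reassoc_of% s2, ← whisker_exchange_assoc,
          associator_inv_naturality_left_assoc, ← comp_whiskerRight, hl, comp_whiskerRight]
      simpa [reassoc_of% s1] using congr(s ≫ $h)
    refine ⟨i ≫ s ≫ (r ⊗ₘ r), ?_, ?_, ?_⟩
    · rw [Category.assoc, Category.assoc, ← hrm.mul_hom, reassoc_of% s1, hir]
    · rw [whiskerLeft_comp, Category.assoc, sep_left_aux μ i r s (by rw [hl', hμ]), reassoc_of% s2,
        ← MonoidalCategory.tensorHom_def'_assoc, hμ, Category.assoc, Category.assoc,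
        reassoc_of% hri, reassoc_of% hps, ← tensorHom_id, tensorHom_comp_tensorHom, hpr,
        Category.id_comp]
    · rw [comp_whiskerRight, Category.assoc, sep_right_aux μ i r s (by rw [hr', hμ]),
        reassoc_of% s3, ← MonoidalCategory.tensorHom_def_assoc, hμ, Category.assoc, Category.assoc,
        reassoc_of% hri, reassoc_of% hps, ← tensorHom_id, tensorHom_comp_tensorHom, hpr,
        Category.id_comp]⟩
  exact ⟨⟨Y⟩, r, i, hrm, hir, hri⟩

theorem mulBy_tensor {B : C} [MonObj B] [IsCommMonObj B] (t : 𝟙_ C ⟶ B ⊗ B) :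
    mulBy t = B ◁ ((λ_ B).inv ≫ t ▷ B ≫ (α_ B B B).hom) ≫ (α_ B B (B ⊗ B)).inv ≫ (μ ⊗ₘ μ) := by
  have h1 : tensorμ B B B B ≫ (μ ⊗ₘ μ) =
      (α_ (B ⊗ B) B B).inv ≫ (β_ (B ⊗ B) B).hom ▷ B ≫ (α_ B (B ⊗ B) B).hom ≫
        B ◁ (α_ B B B).hom ≫ (α_ B B (B ⊗ B)).inv ≫ (μ ⊗ₘ μ) := by
    have h2 : ((μ : B ⊗ B ⟶ B) ⊗ₘ (μ : B ⊗ B ⟶ B)) = (β_ B B).hom ▷ (B ⊗ B) ≫ (μ ⊗ₘ μ) := by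
      rw [← tensorHom_id, tensorHom_comp_tensorHom, IsCommMonObj.mul_comm, Category.id_comp]
    conv_lhs => rw [h2]
    simp only [← Category.assoc]
    congr 1
    rw [BraidedCategory.braiding_tensor_left_hom, tensorμ]
    monoidal
  have h3 : (t ▷ B) ≫ (β_ (B ⊗ B) B).hom = (λ_ B).hom ≫ (ρ_ B).inv ≫ B ◁ t := by
    rw [BraidedCategory.braiding_naturality_left, braiding_tensorUnit_left, Category.assoc]
  rw [mulBy, MonObj.tensorObj.mul_def, h1, associator_inv_naturality_left_assoc,
    ← comp_whiskerRight_assoc, h3]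
  monoidal

theorem mulBy_section {A : C} [MonObj A] [IsCommMonObj A] (s : A ⟶ A ⊗ A)
    (s2 : A ◁ s ≫ (α_ A A A).inv ≫ μ ▷ A = μ ≫ s)
    (s3 : s ▷ A ≫ (α_ A A A).hom ≫ A ◁ μ = μ ≫ s) :
    mulBy (η ≫ s) = μ ≫ s := by
  have h : (λ_ A).inv ≫ (η ≫ s) ▷ A ≫ (α_ A A A).hom ≫ A ◁ μ = s := by
    rw [comp_whiskerRight_assoc, s3, MonObj.one_mul_assoc, Iso.inv_hom_id_assoc]
  rw [mulBy_tensor, ← s2]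
  conv_rhs => rw [← h]
  rw [MonoidalCategory.tensorHom_def']
  simp

/-- The right action of `A` on the first factor of `B ⊗ B`, that is `(b ⊗ a) ⊗ b' ↦ b * f a ⊗ b'`. -/
def actR {A B : C} [MonObj B] (f : A ⟶ B) : (B ⊗ A) ⊗ B ⟶ B ⊗ B := (B ◁ f ≫ μ) ▷ B

/-- The left action of `A` on the second factor of `B ⊗ B`, that is `(b ⊗ a) ⊗ b' ↦ b ⊗ f a * b'`. -/
def actL {A B : C} [MonObj B] (f : A ⟶ B) : (B ⊗ A) ⊗ B ⟶ B ⊗ B :=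
  (α_ B A B).hom ≫ B ◁ (f ▷ B ≫ μ)

section
variable {A B : C} [MonObj A] [MonObj B] [IsCommMonObj B] (f : A ⟶ B)
  [IsMonHom f] (s : A ⟶ A ⊗ A)

theorem sandwich_comp (s1 : s ≫ μ = 𝟙 A) {Z : C} (g : B ⊗ B ⟶ Z) (hg : actR f ≫ g = actL f ≫ g) :
    mulBy (η ≫ s ≫ (f ⊗ₘ f)) ≫ g = g := by
  have hf : (B ◁ f ≫ μ) ▷ B ≫ g = (α_ B A B).hom ≫ B ◁ (f ▷ B ≫ μ) ≫ g := by
    simpa [actR, actL] using hg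
  have e1 : B ◁ ((λ_ B).inv ≫ (η ≫ s ≫ (f ⊗ₘ f)) ▷ B ≫ (α_ B B B).hom) ≫
      (α_ B B (B ⊗ B)).inv ≫ (μ ⊗ₘ μ) =
      B ◁ ((λ_ B).inv ≫ (η ≫ s) ▷ B ≫ (α_ A A B).hom ≫ A ◁ (f ▷ B ≫ μ)) ≫ (α_ B A B).inv ≫
        (B ◁ f ≫ μ) ▷ B := by
    have h1 : (f ⊗ₘ f) ▷ B ≫ (α_ B B B).hom =
        (α_ A A B).hom ≫ A ◁ (f ▷ B) ≫ f ▷ (B ⊗ B) := by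
      rw [← tensorHom_id, associator_naturality, MonoidalCategory.tensorHom_def', tensorHom_id]
    have h2 : B ◁ (f ▷ (B ⊗ B)) ≫ (α_ B B (B ⊗ B)).inv ≫ (μ ⊗ₘ μ) =
        B ◁ (A ◁ μ) ≫ (α_ B A B).inv ≫ (B ◁ f ≫ μ) ▷ B := by
      rw [associator_inv_naturality_right_assoc, associator_inv_naturality_middle_assoc,
        MonoidalCategory.tensorHom_def', comp_whiskerRight, whisker_exchange_assoc]
    rw [← Category.assoc η, comp_whiskerRight, Category.assoc, h1]
    simp only [whiskerLeft_comp, Category.assoc]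
    rw [h2]
  have e2 : (λ_ B).inv ≫ (η ≫ s) ▷ B ≫ (α_ A A B).hom ≫ A ◁ (f ▷ B ≫ μ) ≫ f ▷ B ≫ μ = 𝟙 B := by
    have h1 : (α_ A A B).hom ≫ A ◁ (f ▷ B ≫ μ) ≫ f ▷ B ≫ μ = (μ ≫ f) ▷ B ≫ μ := by
      rw [IsMonHom.mul_hom, comp_whiskerRight_assoc, MonObj.mul_assoc, whisker_exchange_assoc,
        whiskerLeft_comp_assoc, MonoidalCategory.tensorHom_def]
      monoidal
    rw [h1, ← comp_whiskerRight_assoc, Category.assoc, reassoc_of% s1, IsMonHom.one_hom,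
      MonObj.one_mul, Iso.inv_hom_id]
  rw [mulBy_tensor, e1]
  simp only [Category.assoc]
  rw [hf, Iso.inv_hom_id_assoc, ← whiskerLeft_comp_assoc]
  simp only [Category.assoc]
  rw [e2, whiskerLeft_id, Category.id_comp]

theorem sandwich_balanced [IsCommMonObj A]
    (s2 : A ◁ s ≫ (α_ A A A).inv ≫ μ ▷ A = μ ≫ s)
    (s3 : s ▷ A ≫ (α_ A A A).hom ≫ A ◁ μ = μ ≫ s) :
    actR f ≫ mulBy (η ≫ s ≫ (f ⊗ₘ f)) = actL f ≫ mulBy (η ≫ s ≫ (f ⊗ₘ f)) := by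
  have hR : actR f = (β_ B A).hom ▷ B ≫ (α_ A B B).hom ≫
      ((ρ_ A).inv ≫ A ◁ η ≫ (f ⊗ₘ f)) ▷ (B ⊗ B) ≫ μ := by
    have h1 : A ◁ η[A] ≫ (f ⊗ₘ f) = (f ⊗ₘ η) := by
      rw [← id_tensorHom, tensorHom_comp_tensorHom, Category.id_comp, IsMonHom.one_hom]
    have h2 : B ◁ f ≫ μ = (β_ B A).hom ≫ f ▷ B ≫ μ := by
      rw [← BraidedCategory.braiding_naturality_right_assoc, IsCommMonObj.mul_comm]
    rw [h1, MonObj.tensorObj.mul_def, comp_whiskerRight_assoc, tensorμ_natural_left_assoc,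
      tensorHom_comp_tensorHom, MonObj.one_mul, actR, h2, tensorμ, braiding_tensorUnit_left]
    monoidal
  have hL : actL f = (β_ B A).hom ▷ B ≫ (α_ A B B).hom ≫
      ((λ_ A).inv ≫ η ▷ A ≫ (f ⊗ₘ f)) ▷ (B ⊗ B) ≫ μ := by
    have h1 : η[A] ▷ A ≫ (f ⊗ₘ f) = (η ⊗ₘ f) := by
      rw [← tensorHom_id, tensorHom_comp_tensorHom, Category.id_comp, IsMonHom.one_hom]
    have h2 : ((λ_ A).inv ▷ (B ⊗ B)) ≫ tensorμ (𝟙_ C) A B B ≫ ((λ_ B).hom ⊗ₘ (f ▷ B ≫ μ)) =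
        (α_ A B B).inv ≫ (β_ A B).hom ▷ B ≫ (α_ B A B).hom ≫ B ◁ (f ▷ B ≫ μ) := by
      rw [tensorμ]
      monoidal
    rw [h1, MonObj.tensorObj.mul_def, comp_whiskerRight_assoc, tensorμ_natural_left_assoc,
      tensorHom_comp_tensorHom, MonObj.one_mul, actL, h2, Iso.hom_inv_id_assoc,
      ← comp_whiskerRight_assoc, SymmetricCategory.symmetry, id_whiskerRight, Category.id_comp]
  have key : (ρ_ A).inv ≫ A ◁ η ≫ (f ⊗ₘ f) ≫ mulBy (η ≫ s ≫ (f ⊗ₘ f)) =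
      (λ_ A).inv ≫ η ▷ A ≫ (f ⊗ₘ f) ≫ mulBy (η ≫ s ≫ (f ⊗ₘ f)) := by
    rw [← Category.assoc η, ← mulBy_map, mulBy_section s s2 s3]
    simp
  rw [hR, hL]
  simp only [Category.assoc]
  rw [← mul_mulBy, ← comp_whiskerRight_assoc, ← comp_whiskerRight_assoc]
  simp only [Category.assoc]
  rw [key]

end

/-- For a ring homomorphism `f : A ⟶ B`, the map `π : B ⊗ B ⟶ T` exhibits the ring object `T` as the
ring `B ⊗_A B`: it is the coequalizer of the two actions of `A` on `B ⊗ B`, and it is a ring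
homomorphism (which determines the ring structure of `T`). -/
structure IsRelTensor {A B T : C} [MonObj B] [MonObj T] (f : A ⟶ B) (π : B ⊗ B ⟶ T) : Prop where
  isMonHom : IsMonHom π
  condition : actR f ≫ π = actL f ≫ π
  isColimit : Nonempty (IsColimit (Cofork.ofπ π condition))

namespace TTRing

/-- The tensor product of two tt-rings. -/
abbrev tensor (A B : TTRing C) : TTRing C := ⟨A.X ⊗ B.X⟩

variable (C) in
/-- The trivial tt-ring. -/
abbrev unit : TTRing C := ⟨𝟙_ C⟩

/-- The product of two tt-rings. -/
noncomputable abbrev prod [Preadditive C] [HasBinaryBiproducts C] [MonoidalPreadditive C]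
    (A B : TTRing C) : TTRing C := ⟨A.X ⊞ B.X⟩

end TTRing

theorem exists_relTensor [IsIdempotentComplete C] {A B : TTRing C} (f : A.X ⟶ B.X) [hf : IsMonHom f] :
    ∃ (T : TTRing C) (π : B.X ⊗ B.X ⟶ T.X) (i : T.X ⟶ B.X ⊗ B.X),
      IsRelTensor f π ∧ i ≫ π = 𝟙 _ ∧
      ∀ {Z : C} (g : B.X ⊗ B.X ⟶ Z), actR f ≫ g = actL f ≫ g → π ≫ i ≫ g = g := by
  obtain ⟨s, s1, s2, s3⟩ := IsSeparableRing.exists_section (A := A.X)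
  have hbal := sandwich_balanced f s s2 s3
  have hcomp := fun {Z : C} (g : B.X ⊗ B.X ⟶ Z) => sandwich_comp f s s1 g
  have he : (η ≫ s ≫ (f ⊗ₘ f)) ≫ mulBy (η ≫ s ≫ (f ⊗ₘ f)) = η ≫ s ≫ (f ⊗ₘ f) := by
    rw [← Category.assoc η, Category.assoc, ← mulBy_map, mulBy_section s s2 s3]
    simp [reassoc_of% s1]
  obtain ⟨T, π, i, h1, h2, h3⟩ := exists_factor_of_idempotent (B.X ⊗ B.X)
    (mulBy (η ≫ s ≫ (f ⊗ₘ f))) (mulBy_comp_mulBy _ he) (mul_mulBy _)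
  have hv : mulBy (η ≫ s ≫ (f ⊗ₘ f)) ≫ π = π := by
    rw [← h3, Category.assoc, h2]; rw [Category.comp_id]
  have hc : actR f ≫ π = actL f ≫ π := by
    conv_lhs => rw [← hv]
    rw [reassoc_of% hbal, hv]
  have hd : ∀ {Z : C} (g : B.X ⊗ B.X ⟶ Z), actR f ≫ g = actL f ≫ g → π ≫ i ≫ g = g := by
    intro Z g hg
    rw [reassoc_of% h3, hcomp g hg]
  refine ⟨T, π, i, ⟨h1, hc, ⟨Cofork.IsColimit.mk _ (fun c => i ≫ c.π)
    (fun c => hd _ c.condition) (fun c m hm => ?_)⟩⟩, h2, hd⟩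
  rw [← hm]
  simp [reassoc_of% h2]

section
variable [Preadditive C] [HasBinaryBiproducts C]

/-- For homomorphisms of tt-rings `f : A ⟶ B` and `g : B ⟶ B'`, the `B`-algebra `B'` is the complement
of `B` in `B ⊗_A B`: there is an isomorphism of `B`-algebras `h : B ⊗_A B ≅ B × B'` whose first
component is the multiplication. Here `B ⊗_A B` is a `B`-algebra through its left factor,
`b ↦ b ⊗ 1`, and `B × B'` through `b ↦ (b, g b)`. (The first component of the compatibility of `h`
with these algebra structures is automatic, the second one is the last equation.) -/
structure IsSplitting {A B B' : TTRing C} (f : A.X ⟶ B.X) (g : B.X ⟶ B'.X) : Prop where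
  isMonHom : IsMonHom g
  exists_iso : ∃ (T : TTRing C) (π : B.X ⊗ B.X ⟶ T.X) (_ : IsRelTensor f π)
    (h : T.X ≅ B.X ⊞ B'.X), IsMonHom h.hom ∧ π ≫ h.hom ≫ biprod.fst = μ ∧
      (ρ_ B.X).inv ≫ B.X ◁ η ≫ π ≫ h.hom ≫ biprod.snd = g

theorem exists_splitting [MonoidalPreadditive C] [IsIdempotentComplete C] {A B : TTRing C}
    (f : A.X ⟶ B.X) [hf : IsMonHom f] :
    ∃ (B' : TTRing C) (g : B.X ⟶ B'.X), IsSplitting f g := by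
  obtain ⟨T, π, i, hT, hi, hd⟩ := exists_relTensor f
  obtain ⟨t, t1, t2, t3⟩ := IsSeparableRing.exists_section (A := B.X)
  have hπ := hT.isMonHom
  have hμ : π ≫ i ≫ μ[B.X] = μ := hd _ (by simp [actR, actL])
  have hmon : IsMonHom μ[B.X] := ⟨by simp [MonObj.tensorObj.one_def, ← unitors_equal], by
    rw [MonObj.tensorObj.mul_def, Category.assoc, MonObj.mul_mul_mul_comm]⟩
  have epi1 : ∀ {Z : C} {a b : T.X ⟶ Z}, π ≫ a = π ≫ b → a = b := fun {Z a b} h => by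
    simpa [reassoc_of% hi] using congr(i ≫ $h)
  have hii : (i ⊗ₘ i) ≫ (π ⊗ₘ π) = 𝟙 _ := by
    rw [tensorHom_comp_tensorHom, hi, id_tensorHom_id]
  have epi2 : ∀ {Z : C} {a b : T.X ⊗ T.X ⟶ Z}, (π ⊗ₘ π) ≫ a = (π ⊗ₘ π) ≫ b → a = b :=
    fun {Z a b} h => by simpa only [reassoc_of% hii] using congr((i ⊗ₘ i) ≫ $h)
  have hm : IsMonHom (i ≫ μ[B.X]) := by
    refine ⟨?_, epi2 ?_⟩
    · rw [← hπ.one_hom, Category.assoc, hμ, hmon.one_hom]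
    · rw [← hπ.mul_hom_assoc, hμ, hmon.mul_hom, tensorHom_comp_tensorHom_assoc, hμ]
  -- the idempotent of `T` cutting out the factor `B`
  let q : T.X ⟶ T.X := i ≫ μ ≫ t ≫ π
  have hq' : π ≫ q = μ ≫ t ≫ π := by simp only [q]; rw [reassoc_of% hμ]
  have hqq : q ≫ q = q := epi1 (by rw [reassoc_of% hq', hq']; rw [reassoc_of% t1])
  have hql : q ▷ T.X ≫ μ = μ ≫ q := by
    apply epi2
    have h1 : (μ ≫ t) ▷ (B.X ⊗ B.X) ≫ μ = μ ≫ μ ≫ t := by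
      rw [← mulBy_section t t2 t3, mul_mulBy]
    rw [← tensorHom_id, tensorHom_comp_tensorHom_assoc, hq', Category.comp_id,
      ← hπ.mul_hom_assoc, hq', ← reassoc_of% h1, hπ.mul_hom,
      ← tensorHom_id, tensorHom_comp_tensorHom_assoc, Category.id_comp, Category.assoc]
  let p : T.X ⟶ T.X := 𝟙 _ - q
  have hp : p ≫ p = p := by simp [p, hqq]
  have hpl : p ▷ T.X ≫ μ = μ ≫ p := by
    have h1 : p ▷ T.X = 𝟙 _ - q ▷ T.X := by
      rw [eq_sub_iff_add_eq, ← MonoidalPreadditive.add_whiskerRight, sub_add_cancel,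
        id_whiskerRight]
    rw [h1, Preadditive.sub_comp, Preadditive.comp_sub, hql, Category.id_comp, Category.comp_id]
  obtain ⟨B', r, j, hr, hjr, hrj⟩ := exists_factor_of_idempotent T.X p hp hpl
  have hpr : p ≫ r = r := by rw [← hrj, Category.assoc, hjr, Category.comp_id]
  have hjp : j ≫ p = j := by rw [← hrj, reassoc_of% hjr]
  have hqr : t ≫ π ≫ r = 0 := by
    rw [← hpr]
    simp [p, q, reassoc_of% hμ, reassoc_of% t1]
  have hjm : j ≫ i ≫ μ = 0 := by
    rw [← hjp]
    simp [p, q, hμ, t1]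
  have hmap : IsMonHom (biprod.lift (i ≫ μ[B.X]) r) := by
    refine ⟨?_, ?_⟩
    · ext
      · simp [prod_one_def]
      · simp [prod_one_def]
    · ext
      · simp [prod_mul_def]
      · simp [prod_mul_def]
  let h : T.X ≅ B.X ⊞ B'.X :=
    { hom := biprod.lift (i ≫ μ) r
      inv := biprod.desc (t ≫ π) j
      hom_inv_id := by
        rw [biprod.lift_desc, hrj]
        simp [p, q]
      inv_hom_id := by
        ext
        · simp [hμ, t1]
        · simp [hqr]
        · simp [hjm]
        · simp [hjr] }
  have hη := isMonHom_one (A := B.X)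
  refine ⟨B', (ρ_ B.X).inv ≫ B.X ◁ η ≫ π ≫ r, ⟨inferInstance, T, π, hT, h, hmap, ?_, ?_⟩⟩
  · simpa [h] using hμ
  · simp [h]

variable (C) in
/-- A homomorphism of tt-rings, bundled with its source and target. -/
structure TTExt where
  base : TTRing C
  top : TTRing C
  map : base.X ⟶ top.X
  isMonHom : IsMonHom map

section
variable [MonoidalPreadditive C] [IsIdempotentComplete C]

/-- From `f : A ⟶ B` to `g : B ⟶ B'`, where `B ⊗_A B ≅ B × B'`. -/
noncomputable def TTExt.next (E : TTExt C) : TTExt C :=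
  have h := exists_splitting (hf := E.isMonHom) E.map
  { base := E.top
    top := h.choose
    map := h.choose_spec.choose
    isMonHom := h.choose_spec.choose_spec.isMonHom }

theorem TTExt.isSplitting_next (E : TTExt C) :
    IsSplitting (A := E.base) (B := E.top) E.map E.next.map :=
  (exists_splitting (hf := E.isMonHom) E.map).choose_spec.choose_spec

namespace TTRing

/-- The unit `𝟙_ C ⟶ A` of a tt-ring. -/
def unitExt (A : TTRing C) : TTExt C where
  base := unit C
  top := A
  map := η
  isMonHom := isMonHom_one

/-- The `n`-th homomorphism `A^[n] ⟶ A^[n+1]` of the splitting tower of `A`. -/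
noncomputable def towerExt (A : TTRing C) : ℕ → TTExt C
  | 0 => A.unitExt
  | n + 1 => (A.towerExt n).next

/-- The `n`-th tt-ring `A^[n]` of the splitting tower of `A`: one has `A^[0] = 𝟙_ C`, `A^[1] = A` and
`A^[n] ⊗_{A^[n-1]} A^[n] ≅ A^[n] × A^[n+1]` for `n ≥ 1`. -/
noncomputable def tower (A : TTRing C) (n : ℕ) : TTRing C := (A.towerExt n).base

/-- The tt-ring `A` has finite degree `d`. -/
def HasDegree (A : TTRing C) (d : ℕ) : Prop :=
  ¬ IsZero (A.tower d).X ∧ IsZero (A.tower (d + 1)).X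

theorem tower_zero (A : TTRing C) : A.tower 0 = unit C := rfl
theorem tower_one (A : TTRing C) : A.tower 1 = A := rfl

/-- The homomorphisms of the splitting tower. -/
noncomputable def towerMap (A : TTRing C) (n : ℕ) : (A.tower n).X ⟶ (A.tower (n + 1)).X :=
  (A.towerExt n).map

theorem isMonHom_towerMap (A : TTRing C) (n : ℕ) : IsMonHom (A.towerMap n) :=
  (A.towerExt n).isMonHom

theorem isSplitting_towerMap (A : TTRing C) (n : ℕ) :
    IsSplitting (A.towerMap n) (A.towerMap (n + 1)) := (A.towerExt n).isSplitting_next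

theorem isZero_tower_succ (A : TTRing C) (n : ℕ) (h : IsZero (A.tower n).X) :
    IsZero (A.tower (n + 1)).X := by
  have := A.isMonHom_towerMap n
  rw [IsZero.iff_id_eq_zero]
  have h1 : η[(A.tower (n + 1)).X] = 0 := by
    rw [← IsMonHom.one_hom (A.towerMap n), h.eq_of_tgt η 0, zero_comp]
  have h2 := MonObj.one_mul (A.tower (n + 1)).X
  rw [h1, MonoidalPreadditive.zero_whiskerRight, zero_comp] at h2
  rw [← Iso.inv_hom_id (λ_ (A.tower (n + 1)).X), ← h2, comp_zero]

theorem HasDegree.unique {A : TTRing C} {d e : ℕ} (hd : A.HasDegree d) (he : A.HasDegree e) :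
    d = e := by
  have h : ∀ {m n : ℕ}, m ≤ n → IsZero (A.tower m).X → IsZero (A.tower n).X := fun hmn hm =>
    Nat.le_induction hm (fun n _ hn => A.isZero_tower_succ n hn) _ hmn
  rcases lt_trichotomy d e with hlt | heq | hlt
  · exact (he.1 (h hlt hd.2)).elim
  · exact heq
  · exact (hd.1 (h hlt he.2)).elim

end TTRing
end
end
end

section

/-- A functor between triangulated categories is exact if it can be equipped with an isomorphism
with the shifts for which it sends distinguished triangles to distinguished triangles. -/
def IsExactFunctor {K L : Type*} [Category* K] [Category* L]
    [Preadditive K] [HasZeroObject K] [HasShift K ℤ] [∀ n : ℤ, (shiftFunctor K n).Additive]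
    [Pretriangulated K]
    [Preadditive L] [HasZeroObject L] [HasShift L ℤ] [∀ n : ℤ, (shiftFunctor L n).Additive]
    [Pretriangulated L] (F : K ⥤ L) : Prop :=
  ∃ _ : F.CommShift ℤ, F.IsTriangulated

variable (K : Type u) [Category.{v} K]

/-- The tensor product of a triangulated monoidal category is exact in each variable. -/
class TensorTriangulated [Preadditive K] [HasZeroObject K] [HasShift K ℤ]
    [∀ n : ℤ, (shiftFunctor K n).Additive] [Pretriangulated K] [MonoidalCategory K] : Prop where
  tensorLeft_exact (X : K) : IsExactFunctor (tensorLeft X)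
  tensorRight_exact (X : K) : IsExactFunctor (tensorRight X)

instance [Preadditive K] [HasZeroObject K] [HasShift K ℤ]
    [∀ n : ℤ, (shiftFunctor K n).Additive] [Pretriangulated K] [MonoidalCategory K]
    [TensorTriangulated K] : MonoidalPreadditive K := by
  have hl (X : K) : (tensorLeft X).Additive := by
    obtain ⟨_, _⟩ := TensorTriangulated.tensorLeft_exact X
    infer_instance
  have hr (X : K) : (tensorRight X).Additive := by
    obtain ⟨_, _⟩ := TensorTriangulated.tensorRight_exact X
    infer_instance
  exact
    { whiskerLeft_zero := fun {X Y Z} => (tensorLeft X).map_zero Y Z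
      zero_whiskerRight := fun {X Y Z} => (tensorRight X).map_zero Y Z
      whiskerLeft_add := fun {X Y Z} f g => (tensorLeft X).map_add
      add_whiskerRight := fun {X Y Z} f g => (tensorRight X).map_add }

variable {K} in
/-- The tensor powers of an object. -/
def tensorPow [MonoidalCategory K] (X : K) : ℕ → K
  | 0 => 𝟙_ K
  | n + 1 => tensorPow X n ⊗ X

variable {K} in
/-- An object is tensor-nilpotent if one of its tensor powers vanishes. -/
def IsTensorNilpotent [MonoidalCategory K] (X : K) : Prop := ∃ n, IsZero (tensorPow X n)

/-- A tt-category is local if `X ⊗ Y = 0` implies that `X` or `Y` is tensor-nilpotent. -/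
def IsLocalTT [MonoidalCategory K] : Prop :=
  ∀ X Y : K, IsZero (X ⊗ Y) → IsTensorNilpotent X ∨ IsTensorNilpotent Y
end
end TT

namespace TT
-- Zero rings, homomorphisms out of tensor products and products
section
variable {C : Type u} [Category.{v} C] [MonoidalCategory C]

/-! The degree is computed by counting homomorphisms, as one counts the geometric points of a finite
étale algebra. Call two homomorphisms `A ⟶ R` apart if no nonzero `R`-algebra makes them equal. For
a splitting `B ⊗_A B ≅ B × B'`, the factor `B'` represents pairs of homomorphisms out of `B` that
agree on `A` and are apart (`IsSplitting.exists_universal_pair`). By induction `A^[n]` represents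
`n`-tuples of pairwise apart homomorphisms out of `A` (`exists_isUniversalTuple_tower`), so `A^[n] ≠
0` as soon as some nonzero ring receives `n` of them.

Conversely, if `A` has degree `m`, then any `m` pairwise apart homomorphisms `A ⟶ R` are exhausting:
every homomorphism to a nonzero `R`-algebra becomes one of them after a further nonzero extension,
since otherwise there would be `m + 1` of them. Pigeonhole (`IsExhausting.card_le`) and locality, by
which a tensor product of nonzero rings is nonzero, show that a pairwise apart exhausting family
over a nonzero ring has exactly as many members as the degree (`hasDegree_card`).

Over `R = A^[m] ⊗ B^[n]` there are such families for `A` and for `B`. Their disjoint union is one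
for `A × B`, and the pairs form one for `A ⊗ B`; hence the sum and the product of degrees. -/

theorem isZero_of_one_eq_zero [Preadditive C] [MonoidalPreadditive C] (R : C) [MonObj R]
    (h : η[R] = 0) : IsZero R := by
  rw [IsZero.iff_id_eq_zero]
  have h2 := MonObj.one_mul R
  rw [h, MonoidalPreadditive.zero_whiskerRight, zero_comp] at h2
  rw [← Iso.inv_hom_id (λ_ R), ← h2, comp_zero]

theorem isZero_of_isMonHom [Preadditive C] [MonoidalPreadditive C] {R S : C} [MonObj R] [MonObj S]
    (f : R ⟶ S) [IsMonHom f] (h : IsZero R) : IsZero S :=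
  isZero_of_one_eq_zero S (by rw [← IsMonHom.one_hom f, h.eq_of_tgt η 0, zero_comp])

/-- Both `p` and `p ⊗ p` are split epimorphisms, so the identities can be tested after composing
with them. The section `i` need not respect the ring structures. -/
theorem isMonHom_of_splitEpi {R S T : C} [MonObj R] [MonObj S] [MonObj T] (p : R ⟶ S) [IsMonHom p]
    (i : S ⟶ R) (hi : i ≫ p = 𝟙 S) (f : S ⟶ T) (h : IsMonHom (p ≫ f)) : IsMonHom f := by
  have hii : (i ⊗ₘ i) ≫ (p ⊗ₘ p) = 𝟙 _ := by
    rw [tensorHom_comp_tensorHom, hi, id_tensorHom_id]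
  refine ⟨by rw [← IsMonHom.one_hom p, Category.assoc, h.one_hom], ?_⟩
  have h1 : (p ⊗ₘ p) ≫ μ ≫ f = (p ⊗ₘ p) ≫ (f ⊗ₘ f) ≫ μ := by
    rw [← IsMonHom.mul_hom_assoc, h.mul_hom, tensorHom_comp_tensorHom_assoc]
  simpa only [reassoc_of% hii] using congr((i ⊗ₘ i) ≫ $h1)

/-- The unit of `R` factors through every tensor power of `R`, by iterated multiplication, so it
vanishes once a power does. -/
theorem isZero_of_tensorPow [Preadditive C] [MonoidalPreadditive C] (R : C) [MonObj R]
    (h : IsTensorNilpotent R) : IsZero R := by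
  obtain ⟨n, hn⟩ := h
  have key : ∀ n, ∃ (e : 𝟙_ C ⟶ tensorPow R n) (m : tensorPow R n ⟶ R), e ≫ m = η := by
    intro n
    induction n with
    | zero => exact ⟨𝟙 _, η, Category.id_comp _⟩
    | succ n ih =>
      obtain ⟨e, m, h⟩ := ih
      have h' : ((λ_ _).inv ≫ (e ⊗ₘ η)) ≫ (m ⊗ₘ 𝟙 R) ≫ μ = η := by
        rw [Category.assoc, tensorHom_comp_tensorHom_assoc, h, Category.comp_id,
          MonoidalCategory.tensorHom_def', Category.assoc, MonObj.one_mul]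
        simp
      exact ⟨_, _, h'⟩
  obtain ⟨e, m, h⟩ := key n
  exact isZero_of_one_eq_zero R (by rw [← h, hn.eq_of_tgt e 0, zero_comp])

/-- The inclusion `a ↦ a ⊗ 1` of the left factor of a tensor product of rings. -/
def tensorInl (A B : C) [MonObj B] : A ⟶ A ⊗ B := (ρ_ A).inv ≫ A ◁ η

/-- The inclusion `b ↦ 1 ⊗ b` of the right factor of a tensor product of rings. -/
def tensorInr (A B : C) [MonObj A] : B ⟶ A ⊗ B := (λ_ B).inv ≫ η ▷ B

/-- The map `a ⊗ b ↦ f a * g b`. -/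
def tensorDesc {A B R : C} [MonObj R] (f : A ⟶ R) (g : B ⟶ R) : A ⊗ B ⟶ R := (f ⊗ₘ g) ≫ μ

section
variable {A B R S : C} [MonObj A] [MonObj B] [MonObj R] [MonObj S]

omit [MonObj A] in
theorem tensorInl_desc (f : A ⟶ R) (g : B ⟶ R) [IsMonHom g] :
    tensorInl A B ≫ tensorDesc f g = f := by
  have h : A ◁ η[B] ≫ (f ⊗ₘ g) = f ▷ 𝟙_ C ≫ R ◁ η := by
    rw [← id_tensorHom, tensorHom_comp_tensorHom, IsMonHom.one_hom, Category.id_comp,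
      MonoidalCategory.tensorHom_def]
  simp [tensorInl, tensorDesc, reassoc_of% h]

omit [MonObj B] in
theorem tensorInr_desc (f : A ⟶ R) (g : B ⟶ R) [IsMonHom f] :
    tensorInr A B ≫ tensorDesc f g = g := by
  have h : η[A] ▷ B ≫ (f ⊗ₘ g) = 𝟙_ C ◁ g ≫ η ▷ R := by
    rw [← tensorHom_id, tensorHom_comp_tensorHom, IsMonHom.one_hom, Category.id_comp,
      MonoidalCategory.tensorHom_def']
  simp [tensorInr, tensorDesc, reassoc_of% h]

omit [MonObj A] [MonObj B] in
theorem tensorDesc_comp (f : A ⟶ R) (g : B ⟶ R) (h : R ⟶ S) [IsMonHom h] :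
    tensorDesc f g ≫ h = tensorDesc (f ≫ h) (g ≫ h) := by
  simp [tensorDesc]

variable [SymmetricCategory C]

instance : IsMonHom (tensorInl A B) := by
  have := isMonHom_one (A := B)
  unfold tensorInl
  infer_instance

instance : IsMonHom (tensorInr A B) := by
  have := isMonHom_one (A := A)
  unfold tensorInr
  infer_instance

instance [IsCommMonObj R] (f : A ⟶ R) (g : B ⟶ R) [IsMonHom f] [IsMonHom g] :
    IsMonHom (tensorDesc f g) := by
  have hmon : IsMonHom μ[R] := ⟨by simp [MonObj.tensorObj.one_def, ← unitors_equal], by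
    rw [MonObj.tensorObj.mul_def, Category.assoc, MonObj.mul_mul_mul_comm]⟩
  unfold tensorDesc
  infer_instance

/-- This is `(a ⊗ 1) * (1 ⊗ b) = a ⊗ b`; it makes a homomorphism out of `A ⊗ B` determined by its
restrictions to the factors. -/
theorem tensorDesc_inl_inr : tensorDesc (tensorInl A B) (tensorInr A B) = 𝟙 (A ⊗ B) := by
  simp only [tensorDesc, tensorInl, tensorInr, MonObj.tensorObj.mul_def]
  rw [← tensorHom_comp_tensorHom_assoc]
  have h : (A ◁ η[B] ⊗ₘ η[A] ▷ B) = ((𝟙 A ⊗ₘ η[B]) ⊗ₘ (η[A] ⊗ₘ 𝟙 B)) := by simp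
  rw [h, tensorμ_natural_assoc, tensorHom_comp_tensorHom]
  have h1 : (𝟙 A ⊗ₘ η[A]) ≫ μ = (ρ_ A).hom := by simp
  have h2 : (η[B] ⊗ₘ 𝟙 B) ≫ μ = (λ_ B).hom := by simp
  rw [h1, h2, tensorμ, braiding_tensorUnit_left]
  monoidal

theorem tensorDesc_eta (h : A ⊗ B ⟶ R) [IsMonHom h] :
    tensorDesc (tensorInl A B ≫ h) (tensorInr A B ≫ h) = h := by
  rw [← tensorDesc_comp, tensorDesc_inl_inr, Category.id_comp]

theorem tensor_hom_ext {h k : A ⊗ B ⟶ R} [IsMonHom h] [IsMonHom k]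
    (h1 : tensorInl A B ≫ h = tensorInl A B ≫ k) (h2 : tensorInr A B ≫ h = tensorInr A B ≫ k) :
    h = k := by
  rw [← tensorDesc_eta h, h1, h2, tensorDesc_eta]

end

section
variable {A B R : C} [MonObj A] [MonObj B] [MonObj R]

/-- Both sides send `b ⊗ a ⊗ b'` to `u b * u (f a) * v b'`, up to associativity. -/
theorem balanced_tensorDesc {A' : C} (f : A' ⟶ B) (u v : B ⟶ R) [IsMonHom u] [IsMonHom v]
    (h : f ≫ u = f ≫ v) : actR f ≫ tensorDesc u v = actL f ≫ tensorDesc u v := by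
  have h1 : actR f ≫ tensorDesc u v = ((u ⊗ₘ (f ≫ u)) ⊗ₘ v) ≫ μ ▷ R ≫ μ := by
    rw [actR, tensorDesc, ← tensorHom_id, tensorHom_comp_tensorHom_assoc, Category.assoc,
      IsMonHom.mul_hom, ← tensorHom_id, tensorHom_comp_tensorHom_assoc, ← id_tensorHom,
      tensorHom_comp_tensorHom_assoc]
    simp
  have h2 : actL f ≫ tensorDesc u v = (α_ _ _ _).hom ≫ (u ⊗ₘ ((f ≫ v) ⊗ₘ v)) ≫ R ◁ μ ≫ μ := by
    rw [actL, tensorDesc, Category.assoc, ← id_tensorHom, tensorHom_comp_tensorHom_assoc,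
      Category.assoc, IsMonHom.mul_hom, ← id_tensorHom, tensorHom_comp_tensorHom_assoc,
      ← tensorHom_id, tensorHom_comp_tensorHom_assoc]
    simp
  rw [h1, h2, ← h, ← associator_naturality_assoc, MonObj.mul_assoc]

/-- Evaluate the balancing condition on `1 ⊗ a ⊗ 1`. -/
theorem comp_tensorInl_eq {A' T : C} [MonObj A'] (f : A' ⟶ B) [IsMonHom f] (π : B ⊗ B ⟶ T)
    (h : actR f ≫ π = actL f ≫ π) :
    f ≫ tensorInl B B ≫ π = f ≫ tensorInr B B ≫ π := by
  have h1 : (λ_ A').inv ≫ η[B] ▷ A' ≫ (ρ_ _).inv ≫ (B ⊗ A') ◁ η[B] ≫ actR f =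
      f ≫ tensorInl B B := by
    rw [actR, whisker_exchange, rightUnitor_inv_naturality_assoc]
    simp [tensorInl, ← whisker_exchange_assoc]
  have h2 : (λ_ A').inv ≫ η[B] ▷ A' ≫ (ρ_ _).inv ≫ (B ⊗ A') ◁ η[B] ≫ actL f =
      f ≫ tensorInr B B := by
    have : A' ◁ η[B] ≫ f ▷ B ≫ μ = (ρ_ A').hom ≫ f := by
      rw [whisker_exchange_assoc, MonObj.mul_one, rightUnitor_naturality]
    rw [actL, associator_naturality_right_assoc, ← whiskerLeft_comp, this, whiskerLeft_comp]
    simp [tensorInr, ← whisker_exchange]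
  rw [← Category.assoc, ← Category.assoc f (tensorInr B B), ← h1, ← h2]
  simp only [Category.assoc, h]

end

section
variable [Preadditive C] [HasBinaryBiproducts C] {A B R : C} [MonObj A] [MonObj B] [MonObj R]

instance : IsMonHom (biprod.fst : A ⊞ B ⟶ A) :=
  ⟨by simp [prod_one_def], by simp [prod_mul_def]⟩

instance : IsMonHom (biprod.snd : A ⊞ B ⟶ B) :=
  ⟨by simp [prod_one_def], by simp [prod_mul_def]⟩

theorem mulBy_inl [MonoidalPreadditive C] :
    mulBy (η[A] ≫ (biprod.inl : A ⟶ A ⊞ B)) = biprod.fst ≫ biprod.inl := by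
  rw [mulBy]
  ext
  · have h : biprod.inl ▷ A ≫ (biprod.fst : A ⊞ B ⟶ A) ▷ A = 𝟙 (A ⊗ A) := by simp [← comp_whiskerRight]
    simp [prod_mul_def, MonoidalCategory.tensorHom_def', ← whisker_exchange_assoc, reassoc_of% h]
  · simp [prod_mul_def, MonoidalCategory.tensorHom_def', ← whisker_exchange_assoc]
  · simp [prod_mul_def, MonoidalCategory.tensorHom_def', ← whisker_exchange_assoc]
  · have h : biprod.inl ▷ B ≫ (biprod.snd : A ⊞ B ⟶ B) ▷ B = 0 := by simp [← comp_whiskerRight]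
    simp [prod_mul_def, MonoidalCategory.tensorHom_def', ← whisker_exchange_assoc, reassoc_of% h]

/-- `S` is the factor of `R` cut out by the idempotent `e = φ (1, 0)`. Over it the component in `B`
is killed; if it vanishes then `e = 0`, and `φ` kills the component in `A`. -/
theorem exists_factor_prod [MonoidalPreadditive C] [SymmetricCategory C] [IsIdempotentComplete C]
    {R : TTRing C} (φ : A ⊞ B ⟶ R.X) [IsMonHom φ] :
    ∃ (S : TTRing C) (r : R.X ⟶ S.X), IsMonHom r ∧ φ ≫ r = biprod.fst ≫ biprod.inl ≫ φ ≫ r ∧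
      (IsZero S.X → (biprod.inl : A ⟶ A ⊞ B) ≫ φ = 0) := by
  have hm := mulBy_map (η[A] ≫ (biprod.inl : A ⟶ A ⊞ B)) φ
  rw [mulBy_inl] at hm
  have he : ((η[A] ≫ (biprod.inl : A ⟶ A ⊞ B)) ≫ φ) ≫
      mulBy ((η[A] ≫ (biprod.inl : A ⟶ A ⊞ B)) ≫ φ) = (η[A] ≫ (biprod.inl : A ⟶ A ⊞ B)) ≫ φ := by
    rw [Category.assoc, ← hm]
    simp
  obtain ⟨S, r, i, h1, h2, h3⟩ := exists_factor_of_idempotent R.X _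
    (mulBy_comp_mulBy _ he) (mul_mulBy _)
  refine ⟨S, r, h1, ?_, fun hS => ?_⟩
  · have hpr : mulBy ((η[A] ≫ (biprod.inl : A ⟶ A ⊞ B)) ≫ φ) ≫ r = r := by
      rw [← h3, Category.assoc, h2, Category.comp_id]
    rw [Category.assoc] at hm
    nth_rw 1 [← hpr]
    rw [← Category.assoc φ, ← hm]
    simp only [Category.assoc]
  · rw [← h3, hS.eq_of_tgt r 0, zero_comp, comp_zero] at hm
    simpa using congr(biprod.inl ≫ $hm)

end
end

/-! ### Homomorphisms that are apart, and universal tuples -/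

section
variable {C : Type u} [Category.{v} C] [MonoidalCategory C] [SymmetricCategory C]

/-- Two homomorphisms of tt-rings are apart if they become equal only over the zero ring. -/
def Apart {A R : TTRing C} (f g : A.X ⟶ R.X) : Prop :=
  ∀ (S : TTRing C) (h : R.X ⟶ S.X), IsMonHom h → f ≫ h = g ≫ h → IsZero S.X

namespace Apart
variable {A R S : TTRing C} {f g : A.X ⟶ R.X}

theorem symm (h : Apart f g) : Apart g f := fun S k hk e => h S k hk e.symm

theorem comp (h : Apart f g) (k : R.X ⟶ S.X) [IsMonHom k] : Apart (f ≫ k) (g ≫ k) :=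
  fun T l _ e => h T (k ≫ l) inferInstance (by simpa using e)

theorem of_comp {A' : TTRing C} {k : A'.X ⟶ A.X} (h : Apart (k ≫ f) (k ≫ g)) : Apart f g :=
  fun T l hl e => h T l hl (by simp [e])

end Apart

/-- Separability of `A` splits one particular model of `B ⊗_A B`; the coequalizer property carries
the splitting over to any other model. -/
theorem IsRelTensor.exists_section [IsIdempotentComplete C] {A B T : TTRing C} {f : A.X ⟶ B.X}
    [IsMonHom f] {π : B.X ⊗ B.X ⟶ T.X} (hπ : IsRelTensor f π) :
    ∃ i : T.X ⟶ B.X ⊗ B.X, i ≫ π = 𝟙 _ ∧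
      ∀ {Z : C} (g : B.X ⊗ B.X ⟶ Z), actR f ≫ g = actL f ≫ g → π ≫ i ≫ g = g := by
  obtain ⟨T', π', i', h', hi, hd⟩ := exists_relTensor f
  obtain ⟨hc⟩ := hπ.isColimit
  let d := Cofork.IsColimit.desc hc π' h'.condition
  have hπd : π ≫ d = π' := Cofork.IsColimit.π_desc' hc _ _
  have hbal : ∀ {Z : C} (g : B.X ⊗ B.X ⟶ Z), actR f ≫ g = actL f ≫ g →
      π ≫ (d ≫ i') ≫ g = g := fun g hg => by
    rw [Category.assoc, reassoc_of% hπd, hd g hg]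
  refine ⟨d ≫ i', Cofork.IsColimit.hom_ext hc ?_, hbal⟩
  simpa using hbal π hπ.condition

/-- The homomorphisms `x i : A ⟶ T` are pairwise apart, and universal as such. -/
structure IsUniversalTuple {A T : TTRing C} {n : ℕ} (x : Fin n → (A.X ⟶ T.X)) : Prop where
  isMonHom (i : Fin n) : IsMonHom (x i)
  apart : Pairwise fun i j => Apart (x i) (x j)
  exists_desc (R : TTRing C) (f : Fin n → (A.X ⟶ R.X)) (hf : ∀ i, IsMonHom (f i))
    (hap : Pairwise fun i j => Apart (f i) (f j)) :
    ∃ u : T.X ⟶ R.X, IsMonHom u ∧ ∀ i, x i ≫ u = f i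
  hom_ext (R : TTRing C) (u v : T.X ⟶ R.X) (hu : IsMonHom u) (hv : IsMonHom v)
    (h : ∀ i, x i ≫ u = x i ≫ v) : u = v

theorem isUniversalTuple_unit (A : TTRing C) (x : Fin 0 → (A.X ⟶ (TTRing.unit C).X)) :
    IsUniversalTuple x where
  isMonHom i := i.elim0
  apart i := i.elim0
  exists_desc R f _ _ := ⟨η, isMonHom_one, fun i => i.elim0⟩
  hom_ext R u v hu hv _ := by
    have h1 := hu.one_hom
    have h2 := hv.one_hom
    change 𝟙 _ ≫ u = _ at h1
    change 𝟙 _ ≫ v = _ at h2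
    rw [Category.id_comp] at h1 h2
    rw [h1, h2]

theorem TTRing.isUniversalTuple_snoc_id (A : TTRing C) (x : Fin 0 → (A.X ⟶ A.X)) :
    IsUniversalTuple (Fin.snoc x (𝟙 A.X) : Fin 1 → (A.X ⟶ A.X)) := by
  have h : (Fin.snoc x (𝟙 A.X) : Fin 1 → (A.X ⟶ A.X)) = fun _ => 𝟙 A.X := by
    funext i
    obtain rfl : i = Fin.last 0 := Subsingleton.elim (α := Fin 1) _ _
    exact Fin.snoc_last _ _
  rw [h]
  exact
    { isMonHom _ := inferInstance
      apart i j h := (h (Subsingleton.elim (α := Fin 1) i j)).elim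
      exists_desc R f hf _ := ⟨f 0, hf 0, fun i => by
        rw [Subsingleton.elim (α := Fin 1) i 0, Category.id_comp]⟩
      hom_ext R u v _ _ h := by simpa using h 0 }

/-! ### The splitting tower represents tuples of pairwise apart homomorphisms -/

section
variable [Preadditive C] [HasBinaryBiproducts C] [MonoidalPreadditive C] [IsIdempotentComplete C]

/-- For a splitting `B ⊗_A B ≅ B × B'`, the ring `B'` represents the pairs of homomorphisms `B ⟶ R`
which agree on `A` and are apart. -/
theorem IsSplitting.exists_universal_pair {A B B' : TTRing C} {f : A.X ⟶ B.X} [IsMonHom f]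
    {g : B.X ⟶ B'.X} (hg : IsSplitting f g) :
    ∃ g' : B.X ⟶ B'.X, IsMonHom g' ∧ f ≫ g = f ≫ g' ∧ Apart g g' ∧
      (∀ (R : TTRing C) (u v : B.X ⟶ R.X), IsMonHom u → IsMonHom v → f ≫ u = f ≫ v → Apart u v →
        ∃ w : B'.X ⟶ R.X, IsMonHom w ∧ g ≫ w = u ∧ g' ≫ w = v) ∧
      (∀ (R : TTRing C) (w w' : B'.X ⟶ R.X), IsMonHom w → IsMonHom w' → g ≫ w = g ≫ w' →
        g' ≫ w = g' ≫ w' → w = w') := by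
  obtain ⟨T, π, hT, h, hh, h1, h2⟩ := hg.exists_iso
  obtain ⟨i, hi, hd⟩ := hT.exists_section
  have hπ := hT.isMonHom
  have hπepi : ∀ {Z : C} {a b : T.X ⟶ Z}, π ≫ a = π ≫ b → a = b := fun {Z a b} e => by
    simpa [reassoc_of% hi] using congr(i ≫ $e)
  have hinl : tensorInl B.X B.X ≫ π ≫ h.hom ≫ biprod.snd = g := by
    simpa [tensorInl] using h2
  -- While `g` is `b ↦ b ⊗ 1` projected to `B'`, the second homomorphism is `b ↦ 1 ⊗ b` projected to
  -- `B'`.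
  obtain ⟨g', hg'⟩ : ∃ g' : B.X ⟶ B'.X, g' = tensorInr B.X B.X ≫ π ≫ h.hom ≫ biprod.snd := ⟨_, rfl⟩
  have hgm := hg.isMonHom
  have hgm' : IsMonHom g' := by rw [hg']; infer_instance
  have hq : tensorDesc g g' = π ≫ h.hom ≫ biprod.snd := by
    rw [← hinl, hg', tensorDesc_eta]
  refine ⟨g', hgm', ?_, ?_, ?_, ?_⟩
  · have := comp_tensorInl_eq f π hT.condition
    simp only [← hinl, hg']
    simp only [← Category.assoc] at this ⊢
    rw [this]
  · intro S k hk e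
    -- If `g` and `g'` agree after `k`, then `b ⊗ b'` goes to `k (g (b * b'))`. So the map from `B ×
    -- B'` to `S` factors through the projection to `B`, and `k`, its restriction to the summand
    -- `B'`, is zero.
    have e1 : π ≫ h.hom ≫ biprod.snd ≫ k = π ≫ h.hom ≫ biprod.fst ≫ g ≫ k := by
      rw [reassoc_of% h1, ← reassoc_of% hq, tensorDesc_comp, ← e, tensorDesc, IsMonHom.mul_hom]
    have e2 : (biprod.snd : B.X ⊞ B'.X ⟶ _) ≫ k = biprod.fst ≫ g ≫ k := by
      have := hπepi e1
      rwa [cancel_epi] at this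
    have e3 : k = 0 := by simpa using congr(biprod.inr ≫ $e2)
    exact isZero_of_one_eq_zero S.X (by rw [← IsMonHom.one_hom k, e3, comp_zero])
  · intro R u v hu hv huv hap
    have hb := hd _ (balanced_tensorDesc f u v huv)
    obtain ⟨t, ht⟩ : ∃ t : T.X ⟶ R.X, t = i ≫ tensorDesc u v := ⟨_, rfl⟩
    rw [← ht] at hb
    have htm : IsMonHom t := isMonHom_of_splitEpi π i hi t (by rw [hb]; infer_instance)
    have hinvm : IsMonHom h.inv :=
      isMonHom_of_splitEpi h.hom h.inv h.inv_hom_id _ (by rw [h.hom_inv_id]; infer_instance)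
    -- Over the factor `S` of `R` belonging to the component `B`, the image of `b ⊗ b'` depends only
    -- on `b * b'`. Thus `u` and `v` agree there, `S` is zero by apartness, and the induced map
    -- factors through `B'`.
    obtain ⟨S, r, hr, hr1, hr2⟩ := exists_factor_prod (h.inv ≫ t)
    have hS : IsZero S.X := by
      apply hap S r hr
      have e1 : tensorDesc u v ≫ r = μ ≫ biprod.inl ≫ (h.inv ≫ t) ≫ r := by
        rw [← h1, ← hb]
        simp only [Category.assoc]
        simp only [Category.assoc] at hr1
        rw [← hr1, Iso.hom_inv_id_assoc]
      have e2 := congr(tensorInl B.X B.X ≫ $e1)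
      have e3 := congr(tensorInr B.X B.X ≫ $e1)
      rw [← Category.assoc, tensorInl_desc] at e2
      rw [← Category.assoc, tensorInr_desc] at e3
      rw [e2, e3]
      simp [tensorInl, tensorInr]
    have hz := hr2 hS
    have hw : h.inv ≫ t = biprod.snd ≫ biprod.inr ≫ h.inv ≫ t := by
      ext
      · simp [hz]
      · simp
    refine ⟨biprod.inr ≫ h.inv ≫ t, isMonHom_of_splitEpi biprod.snd biprod.inr (by simp) _
      (by rw [← hw]; infer_instance), ?_, ?_⟩
    · rw [← hinl]
      simp only [Category.assoc]
      rw [← hw, Iso.hom_inv_id_assoc, hb]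
      simpa using tensorInl_desc u v
    · rw [hg']
      simp only [Category.assoc]
      rw [← hw, Iso.hom_inv_id_assoc, hb]
      simpa using tensorInr_desc u v
  · intro R w w' hw hw' e1 e2
    have e3 : tensorDesc g g' ≫ w = tensorDesc g g' ≫ w' := by
      rw [tensorDesc_comp, tensorDesc_comp, e1, e2]
    rw [hq] at e3
    simp only [Category.assoc] at e3
    have e4 := hπepi e3
    rw [cancel_epi] at e4
    simpa using congr(biprod.inr ≫ $e4)

/-- Here `f` forgets the last entry of an `(n + 1)`-tuple. Two homomorphisms out of `T'` agreeing on
`T` are two tuples with the same first `n` entries, and they are apart when their last entries are.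
Such a pair is the same as an `(n + 2)`-tuple. -/
theorem IsUniversalTuple.succ {A T T' T'' : TTRing C} {n : ℕ} {x : Fin n → (A.X ⟶ T.X)}
    {f : T.X ⟶ T'.X} [IsMonHom f] {y : A.X ⟶ T'.X} (hx : IsUniversalTuple x)
    (hy : IsUniversalTuple (Fin.snoc (fun i => x i ≫ f) y : Fin (n + 1) → (A.X ⟶ T'.X)))
    {g : T'.X ⟶ T''.X} (hg : IsSplitting f g) :
    ∃ z : A.X ⟶ T''.X, IsUniversalTuple
      (Fin.snoc (fun i => (Fin.snoc (fun i => x i ≫ f) y : Fin (n + 1) → (A.X ⟶ T'.X)) i ≫ g) z :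
        Fin (n + 2) → (A.X ⟶ T''.X)) := by
  obtain ⟨g', hg', hfg, hap, hdesc, hext⟩ := hg.exists_universal_pair
  have hgm := hg.isMonHom
  have hym : IsMonHom y := by simpa using hy.isMonHom (Fin.last n)
  have hlast : ∀ {R : TTRing C} (u v : T'.X ⟶ R.X), IsMonHom u → IsMonHom v →
      f ≫ u = f ≫ v → y ≫ u = y ≫ v → u = v := fun {R} u v hu hv h1 h2 =>
    hy.hom_ext R u v hu hv (fun i => by
      refine Fin.lastCases ?_ (fun i => ?_) i
      · simpa using h2
      · simp [h1])
  have hcast : ∀ i : Fin n, x i ≫ f ≫ g = x i ≫ f ≫ g' := fun i => by rw [hfg]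
  have hz : ∀ i, Apart ((Fin.snoc (fun i => x i ≫ f) y : Fin (n + 1) → (A.X ⟶ T'.X)) i ≫ g)
      (y ≫ g') := fun i => by
    refine Fin.lastCases ?_ (fun i => ?_) i
    · intro S h hh e
      simp only [Fin.snoc_last, Category.assoc] at e
      exact hap S h hh (hlast _ _ inferInstance inferInstance
        (by rw [reassoc_of% hfg]) e)
    · have h1 := (hy.apart (Fin.castSucc_lt_last i).ne).comp g'
      simp only [Fin.snoc_castSucc, Fin.snoc_last, Category.assoc] at h1 ⊢
      rwa [hfg]
  refine ⟨y ≫ g', ⟨fun i => ?_, fun i j hij => ?_, fun R k hk hkap => ?_, fun R u v hu hv h => ?_⟩⟩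
  · refine Fin.lastCases ?_ (fun i => ?_) i
    · simp only [Fin.snoc_last]; infer_instance
    · have := hy.isMonHom i
      simp only [Fin.snoc_castSucc (α := fun _ => A.X ⟶ T''.X)]; infer_instance
  · induction i using Fin.lastCases with
    | last =>
      induction j using Fin.lastCases with
      | last => exact (hij rfl).elim
      | cast j =>
        simp only [Fin.snoc_castSucc (α := fun _ => A.X ⟶ T''.X), Fin.snoc_last]
        exact (hz j).symm
    | cast i =>
      induction j using Fin.lastCases with
      | last =>
        simp only [Fin.snoc_castSucc (α := fun _ => A.X ⟶ T''.X), Fin.snoc_last]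
        exact hz i
      | cast j =>
        simp only [Fin.snoc_castSucc (α := fun _ => A.X ⟶ T''.X)]
        exact (hy.apart (fun e => hij (by rw [e]))).comp g
  -- `u` classifies the tuple without its last entry, `v` the tuple without its penultimate one.
  · obtain ⟨u, hu, hu'⟩ := hy.exists_desc R (fun i => k i.castSucc) (fun i => hk _)
      (fun i j hij => hkap (by simpa using hij))
    obtain ⟨v, hv, hv'⟩ := hy.exists_desc R
      (Fin.snoc (fun i : Fin n => k i.castSucc.castSucc) (k (Fin.last _)))
      (fun i => by
        refine Fin.lastCases ?_ (fun i => ?_) i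
        · simpa using hk _
        · simpa using hk _)
      (fun i j hij => by
        induction i using Fin.lastCases with
        | last =>
          induction j using Fin.lastCases with
          | last => exact (hij rfl).elim
          | cast j => simpa using hkap (Fin.castSucc_lt_last _).ne'
        | cast i =>
          induction j using Fin.lastCases with
          | last => simpa using hkap (Fin.castSucc_lt_last _).ne
          | cast j => simpa using hkap (by simpa using hij))
    have hul : y ≫ u = k (Fin.last n).castSucc := by simpa using hu' (Fin.last n)
    have hvl : y ≫ v = k (Fin.last (n + 1)) := by simpa using hv' (Fin.last n)
    have hfuv : f ≫ u = f ≫ v := hx.hom_ext R _ _ inferInstance inferInstance fun i => by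
      have h1 := hu' i.castSucc
      have h2 := hv' i.castSucc
      simp only [Fin.snoc_castSucc, Category.assoc] at h1 h2
      rw [h1, h2]
    obtain ⟨w, hw, h1, h2⟩ := hdesc R u v hu hv hfuv
      (Apart.of_comp (k := y) (by rw [hul, hvl]; exact hkap (Fin.castSucc_lt_last _).ne))
    refine ⟨w, hw, fun i => ?_⟩
    induction i using Fin.lastCases with
    | last => simp [h2, hvl]
    | cast i =>
      simp only [Fin.snoc_castSucc (α := fun _ => A.X ⟶ T''.X), Category.assoc]
      rw [h1, hu']
  · refine hext R u v hu hv ?_ ?_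
    · refine hy.hom_ext R _ _ inferInstance inferInstance fun i => ?_
      have := h i.castSucc
      simpa only [Fin.snoc_castSucc (α := fun _ => A.X ⟶ T''.X), Category.assoc] using this
    · refine hlast _ _ inferInstance inferInstance ?_ (by simpa using h (Fin.last _))
      rw [← reassoc_of% hfg, ← reassoc_of% hfg]
      refine hx.hom_ext R _ _ inferInstance inferInstance fun i => ?_
      have := h i.castSucc.castSucc
      simp only [Fin.snoc_castSucc (α := fun _ => A.X ⟶ T''.X),
        Fin.snoc_castSucc (α := fun _ => A.X ⟶ T'.X), Category.assoc] at this
      simpa using this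

namespace TTRing

theorem exists_isUniversalTuple_tower (A : TTRing C) (n : ℕ) :
    ∃ x : Fin n → (A.X ⟶ (A.tower n).X), IsUniversalTuple x := by
  -- Two consecutive levels are carried along, because a splitting involves three successive rings
  -- and the transition map must be known to forget the last entry.
  have key : ∀ n, ∃ (x : Fin n → (A.X ⟶ (A.tower n).X)) (y : A.X ⟶ (A.tower (n + 1)).X),
      IsUniversalTuple x ∧ IsUniversalTuple
        (Fin.snoc (fun i => x i ≫ A.towerMap n) y : Fin (n + 1) → (A.X ⟶ (A.tower (n + 1)).X)) := by
    intro n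
    induction n with
    | zero =>
      refine ⟨fun i => i.elim0, 𝟙 _, isUniversalTuple_unit A _, ?_⟩
      exact A.isUniversalTuple_snoc_id _
    | succ n ih =>
      obtain ⟨x, y, hx, hy⟩ := ih
      have := A.isMonHom_towerMap n
      obtain ⟨z, hz⟩ := hx.succ hy (A.isSplitting_towerMap n)
      exact ⟨_, z, hy, hz⟩
  obtain ⟨x, y, hx, hy⟩ := key n
  exact ⟨x, hx⟩

/-- Any `n` members of the family are classified by a homomorphism from `A^[n]` to a nonzero ring.
-/
theorem not_isZero_tower {A R : TTRing C} {J : Type*} [Fintype J] {n : ℕ}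
    (hn : n ≤ Fintype.card J) (hR : ¬ IsZero R.X) (f : J → (A.X ⟶ R.X)) (hf : ∀ i, IsMonHom (f i))
    (hap : Pairwise fun i j => Apart (f i) (f j)) : ¬ IsZero (A.tower n).X := by
  intro h
  obtain ⟨x, hx⟩ := A.exists_isUniversalTuple_tower n
  obtain ⟨e⟩ : Nonempty (Fin n ↪ J) := Function.Embedding.nonempty_of_card_le (by simpa using hn)
  obtain ⟨u, hu, -⟩ := hx.exists_desc R (fun i => f (e i)) (fun i => hf _)
    (fun i j hij => hap (e.injective.ne hij))
  exact hR (isZero_of_isMonHom u h)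

end TTRing
end
end

/-! ### Exhausting families and the degree -/

section
variable {C : Type u} [Category.{v} C] [MonoidalCategory C] [SymmetricCategory C]

/-- A finite conjunction of properties of homomorphisms out of `R`, each of which persists and can be
attained over every nonzero `R`-algebra, can be attained over a nonzero `R`-algebra. -/
theorem exists_hom_forall {R : TTRing C} (hR : ¬ IsZero R.X) {J : Type*} [Fintype J]
    (P : J → ∀ S : TTRing C, (R.X ⟶ S.X) → Prop)
    (hcomp : ∀ j (S S' : TTRing C) (h : R.X ⟶ S.X) (h' : S.X ⟶ S'.X), IsMonHom h → IsMonHom h' →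
      P j S h → P j S' (h ≫ h'))
    (hex : ∀ j (S : TTRing C) (h : R.X ⟶ S.X), IsMonHom h → ¬ IsZero S.X →
      ∃ (S' : TTRing C) (h' : S.X ⟶ S'.X), IsMonHom h' ∧ ¬ IsZero S'.X ∧ P j S' (h ≫ h')) :
    ∃ (S : TTRing C) (h : R.X ⟶ S.X), IsMonHom h ∧ ¬ IsZero S.X ∧ ∀ j, P j S h := by
  classical
  have key : ∀ s : Finset J, ∃ (S : TTRing C) (h : R.X ⟶ S.X), IsMonHom h ∧ ¬ IsZero S.X ∧
      ∀ j ∈ s, P j S h := by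
    intro s
    induction s using Finset.induction_on with
    | empty => exact ⟨R, 𝟙 _, inferInstance, hR, by simp⟩
    | insert j s _ ih =>
      obtain ⟨S, h, hh, hS, hP⟩ := ih
      obtain ⟨S', h', hh', hS', hP'⟩ := hex j S h hh hS
      refine ⟨S', h ≫ h', inferInstance, hS', fun k hk => ?_⟩
      obtain rfl | hk := Finset.mem_insert.1 hk
      · exact hP'
      · exact hcomp k S S' h h' hh hh' (hP k hk)
  obtain ⟨S, h, hh, hS, hP⟩ := key Finset.univ
  exact ⟨S, h, hh, hS, fun j => hP j (Finset.mem_univ j)⟩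

/-- A family of homomorphisms `ψ j : D ⟶ R` is exhausting if every homomorphism from `D` to a nonzero
`R`-algebra `S` becomes equal to some `ψ j` over a nonzero `S`-algebra. -/
def IsExhausting {D R : TTRing C} {J : Type*} (ψ : J → (D.X ⟶ R.X)) : Prop :=
  ∀ (S : TTRing C) (h : R.X ⟶ S.X) (φ : D.X ⟶ S.X), IsMonHom h → IsMonHom φ → ¬ IsZero S.X →
    ∃ (S' : TTRing C) (h' : S.X ⟶ S'.X) (j : J), IsMonHom h' ∧ ¬ IsZero S'.X ∧
      φ ≫ h' = ψ j ≫ h ≫ h'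

/-- Pigeonhole: over a suitable nonzero algebra each `f i` equals some `ψ j`, and two indices `i`
with the same `j` would give homomorphisms that agree there, against apartness. -/
theorem IsExhausting.card_le {D R S : TTRing C} {J I : Type*} [Fintype J] [Fintype I]
    {ψ : J → (D.X ⟶ R.X)} (hψ : IsExhausting ψ) (h : R.X ⟶ S.X) [IsMonHom h] (hS : ¬ IsZero S.X)
    (f : I → (D.X ⟶ S.X)) (hf : ∀ i, IsMonHom (f i))
    (hap : Pairwise fun i j => Apart (f i) (f j)) : Fintype.card I ≤ Fintype.card J := by
  obtain ⟨T, k, hk, hT, hP⟩ := exists_hom_forall hS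
    (fun i T k => ∃ j, f i ≫ k = ψ j ≫ h ≫ k)
    (fun i T T' k k' _ _ ⟨j, hj⟩ => ⟨j, by rw [reassoc_of% hj]⟩)
    (fun i T k hk hT => by
      obtain ⟨T', k', j, hk', hT', e⟩ := hψ T (h ≫ k) (f i ≫ k) inferInstance inferInstance hT
      exact ⟨T', k', hk', hT', j, by simpa using e⟩)
  choose j hj using hP
  refine Fintype.card_le_of_injective j fun a b hab => ?_
  by_contra hne
  exact hT (hap hne T k hk (by rw [hj, hj, hab]))

section
variable [Preadditive C] [HasBinaryBiproducts C] [MonoidalPreadditive C] [IsIdempotentComplete C]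

omit [HasBinaryBiproducts C] [IsIdempotentComplete C] in
-- Locality enters the argument only here: a tensor-nilpotent ring is zero.
theorem IsLocalTT.not_isZero_tensor (hC : IsLocalTT C) {A B : TTRing C} (hA : ¬ IsZero A.X)
    (hB : ¬ IsZero B.X) : ¬ IsZero (A.tensor B).X := fun h =>
  (hC A.X B.X h).elim (fun h => hA (isZero_of_tensorPow _ h)) (fun h => hB (isZero_of_tensorPow _ h))

namespace TTRing

/-- A homomorphism `φ` that never meets the family over a nonzero algebra would extend it to `m + 1`
pairwise apart homomorphisms, but `A^[m+1] = 0`. -/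
theorem HasDegree.isExhausting {A R : TTRing C} {m : ℕ} (hA : A.HasDegree m) {J : Type*} [Fintype J]
    (hJ : Fintype.card J = m) (x : J → (A.X ⟶ R.X)) (hx : ∀ j, IsMonHom (x j))
    (hap : Pairwise fun i j => Apart (x i) (x j)) : IsExhausting x := by
  intro S h φ hh hφ hS
  by_contra! hne
  have hφap : ∀ j, Apart φ (x j ≫ h) := fun j T k hk e => by
    by_contra hT
    exact hne T k j hk hT (by simpa using e)
  refine not_isZero_tower (J := Option J) (n := m + 1) (by simp [hJ]) hS
    (fun o => o.elim φ (fun j => x j ≫ h)) (fun o => ?_) (fun a b hab => ?_) hA.2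
  · cases o
    · exact hφ
    · exact inferInstanceAs (IsMonHom (x _ ≫ h))
  · cases a <;> cases b
    · exact (hab rfl).elim
    · exact hφap _
    · exact (hφap _).symm
    · exact (hap (by simpa using hab)).comp h

theorem hasDegree_card (hC : IsLocalTT C) {D R : TTRing C} {J : Type*} [Fintype J]
    (hR : ¬ IsZero R.X) (ψ : J → (D.X ⟶ R.X)) (hψ : ∀ j, IsMonHom (ψ j))
    (hap : Pairwise fun i j => Apart (ψ i) (ψ j)) (hex : IsExhausting ψ) :
    D.HasDegree (Fintype.card J) := by
  refine ⟨not_isZero_tower le_rfl hR ψ hψ hap, ?_⟩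
  by_contra hne
  obtain ⟨x, hx⟩ := D.exists_isUniversalTuple_tower (Fintype.card J + 1)
  have hxm := hx.isMonHom
  -- To compare the universal tuple of length `card J + 1` with `ψ`, both are moved to the tensor
  -- product of their targets, which is nonzero by locality.
  have := hex.card_le (S := R.tensor (D.tower (Fintype.card J + 1))) (tensorInl _ _)
    (hC.not_isZero_tensor hR hne) (fun i => x i ≫ tensorInr _ _) (fun i => inferInstance)
    (fun i j hij => (hx.apart hij).comp (S := R.tensor (D.tower (Fintype.card J + 1)))
      (tensorInr _ _))
  simp at this

/-! ### Families for the product and for the tensor product -/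

variable {A B R : TTRing C} {I J : Type*} {x : I → (A.X ⟶ R.X)} {y : J → (B.X ⟶ R.X)}

omit [IsIdempotentComplete C] in
-- On the summand `A` the second homomorphism is zero, so equality over `S` kills the image of the
-- unit of `A`, which is the unit of `S`.
theorem apart_fst_snd {f : A.X ⟶ R.X} {g : B.X ⟶ R.X} (hf : IsMonHom f) :
    Apart (A := A.prod B) (biprod.fst ≫ f) (biprod.snd ≫ g) := by
  intro S h hh e
  have h1 : f ≫ h = 0 := by simpa using congr(biprod.inl ≫ $e)
  exact isZero_of_one_eq_zero S.X (by rw [← IsMonHom.one_hom (f ≫ h), h1, comp_zero])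

omit [IsIdempotentComplete C] in
theorem apart_fst {f g : A.X ⟶ R.X} (h : Apart f g) :
    Apart (A := A.prod B) (biprod.fst ≫ f) (biprod.fst ≫ g) :=
  fun S k hk e => h S k hk (by simpa using congr(biprod.inl ≫ $e))

omit [IsIdempotentComplete C] in
theorem apart_snd {f g : B.X ⟶ R.X} (h : Apart f g) :
    Apart (A := A.prod B) (biprod.snd ≫ f) (biprod.snd ≫ g) :=
  fun S k hk e => h S k hk (by simpa using congr(biprod.inr ≫ $e))

/-- Cut `S` by the idempotent `φ (1, 0)`. If the resulting factor is nonzero, `φ` factors over it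
through `A`; otherwise `φ` already factors through `B`. -/
theorem isExhausting_prod (hx : IsExhausting x) (hy : IsExhausting y) :
    IsExhausting (D := A.prod B)
      (Sum.elim (fun i => biprod.fst ≫ x i) (fun j => biprod.snd ≫ y j)) := by
  intro S h φ hh hφ hS
  obtain ⟨T, r, hr, h1, h2⟩ := exists_factor_prod φ
  by_cases hT : IsZero T.X
  · have h3 : φ = biprod.snd ≫ biprod.inr ≫ φ := by
      ext
      · simp [h2 hT]
      · simp
    have h4 : IsMonHom (biprod.inr ≫ φ) :=
      isMonHom_of_splitEpi (biprod.snd : A.X ⊞ B.X ⟶ B.X) biprod.inr (by simp) _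
        (by rw [← h3]; exact hφ)
    obtain ⟨S', h', j, hh', hS', e⟩ := hy S h _ hh h4 hS
    refine ⟨S', h', Sum.inr j, hh', hS', ?_⟩
    rw [h3]
    simpa using congr(biprod.snd ≫ $e)
  · have h4 : IsMonHom (biprod.inl ≫ φ ≫ r) :=
      isMonHom_of_splitEpi (biprod.fst : A.X ⊞ B.X ⟶ A.X) biprod.inl (by simp) _
        (by rw [← h1]; infer_instance)
    obtain ⟨S', h', j, hh', hS', e⟩ := hx T (h ≫ r) _ inferInstance h4 hT
    refine ⟨S', r ≫ h', Sum.inl j, inferInstance, hS', ?_⟩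
    rw [reassoc_of% h1]
    simpa using congr(biprod.fst ≫ $e)

omit [Preadditive C] [HasBinaryBiproducts C] [MonoidalPreadditive C] [IsIdempotentComplete C] in
-- Match the restriction to `A` first, then the restriction to `B` over the algebra so obtained;
-- equality on `A` persists.
theorem isExhausting_tensor (hxm : ∀ i, IsMonHom (x i)) (hym : ∀ j, IsMonHom (y j))
    (hx : IsExhausting x) (hy : IsExhausting y) :
    IsExhausting (D := A.tensor B) (fun p : I × J => tensorDesc (x p.1) (y p.2)) := by
  intro S h φ hh hφ hS
  obtain ⟨T, k, i, hk, hT, e⟩ := hx S h (tensorInl _ _ ≫ φ) hh inferInstance hS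
  obtain ⟨T', k', j, hk', hT', e'⟩ := hy T (h ≫ k) (tensorInr _ _ ≫ φ ≫ k) inferInstance
    inferInstance hT
  refine ⟨T', k ≫ k', (i, j), inferInstance, hT', tensor_hom_ext ?_ ?_⟩
  · change _ = _ ≫ tensorDesc (x i) (y j) ≫ h ≫ k ≫ k'
    rw [← Category.assoc (tensorInl _ _) (tensorDesc _ _), tensorInl_desc]
    simp only [Category.assoc] at e
    rw [reassoc_of% e]
  · change _ = _ ≫ tensorDesc (x i) (y j) ≫ h ≫ k ≫ k'
    rw [← Category.assoc (tensorInr _ _) (tensorDesc _ _), tensorInr_desc]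
    simpa using e'

theorem hasDegree_prod_tensor (hC : IsLocalTT C) {m n : ℕ} (hA : A.HasDegree m)
    (hB : B.HasDegree n) :
    (A.prod B).HasDegree (m + n) ∧ (A.tensor B).HasDegree (m * n) := by
  obtain ⟨a, ha⟩ := A.exists_isUniversalTuple_tower m
  obtain ⟨b, hb⟩ := B.exists_isUniversalTuple_tower n
  -- A common nonzero ring that carries both universal tuples.
  obtain ⟨R, hR⟩ : ∃ R, R = (A.tower m).tensor (B.tower n) := ⟨_, rfl⟩
  have hR0 : ¬ IsZero R.X := by rw [hR]; exact hC.not_isZero_tensor hA.1 hB.1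
  obtain ⟨x, hxm, hxap⟩ : ∃ x : Fin m → (A.X ⟶ R.X), (∀ i, IsMonHom (x i)) ∧
      Pairwise fun i j => Apart (x i) (x j) := by
    have := ha.isMonHom
    subst hR
    exact ⟨fun i => a i ≫ tensorInl _ _, fun i => inferInstance,
      fun i j hij => (ha.apart hij).comp (S := (A.tower m).tensor (B.tower n)) (tensorInl _ _)⟩
  obtain ⟨y, hym, hyap⟩ : ∃ y : Fin n → (B.X ⟶ R.X), (∀ i, IsMonHom (y i)) ∧
      Pairwise fun i j => Apart (y i) (y j) := by
    have := hb.isMonHom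
    subst hR
    exact ⟨fun i => b i ≫ tensorInr _ _, fun i => inferInstance,
      fun i j hij => (hb.apart hij).comp (S := (A.tower m).tensor (B.tower n)) (tensorInr _ _)⟩
  have hx := hA.isExhausting (by simp) x hxm hxap
  have hy := hB.isExhausting (by simp) y hym hyap
  constructor
  · have := hasDegree_card hC (D := A.prod B) hR0 _ ?_ ?_ (isExhausting_prod hx hy)
    · simpa using this
    · rintro (i | j)
      · exact inferInstanceAs (IsMonHom (biprod.fst ≫ x i))
      · exact inferInstanceAs (IsMonHom (biprod.snd ≫ y j))
    · rintro (i | i) (j | j) hij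
      · exact apart_fst (hxap (by simpa using hij))
      · exact apart_fst_snd (hxm i)
      · exact (apart_fst_snd (hxm j)).symm
      · exact apart_snd (hyap (by simpa using hij))
  · have := hasDegree_card hC (D := A.tensor B) hR0 _ ?_ ?_ (isExhausting_tensor hxm hym hx hy)
    · simpa using this
    · exact fun p => inferInstanceAs (IsMonHom (tensorDesc (x p.1) (y p.2)))
    · rintro ⟨i, j⟩ ⟨i', j'⟩ hij
      -- Distinct pairs differ in a coordinate, and apartness can be checked after restriction to
      -- the corresponding tensor factor.
      by_cases hi : i = i'
      · refine Apart.of_comp (A' := B) (k := tensorInr _ _) ?_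
        rw [tensorInr_desc, tensorInr_desc]
        exact hyap fun hj => hij (Prod.ext hi hj)
      · refine Apart.of_comp (A' := A) (k := tensorInl _ _) ?_
        rw [tensorInl_desc, tensorInl_desc]
        exact hxap hi

end TTRing
end
end
end TT
theorem corollary3p10 {K : Type u} [Category.{v} K] [Preadditive K] [HasZeroObject K]
    [HasShift K ℤ] [∀ n : ℤ, (shiftFunctor K n).Additive] [Pretriangulated K] [IsTriangulated K]
    [MonoidalCategory K] [SymmetricCategory K] [TT.TensorTriangulated K]
    [EssentiallySmall.{w} K] [IsIdempotentComplete K] (hK : TT.IsLocalTT K)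
    (A B : TT.TTRing K) (m n : ℕ) (hA : A.HasDegree m) (hB : B.HasDegree n) :
    (A.prod B).HasDegree (m + n) ∧ (A.tensor B).HasDegree (m * n) :=
  TT.TTRing.hasDegree_prod_tensor hK hA hB
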